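/- **Theorem.** A topological space $Y$ is a *C-space* if for every sequence $\mathcal U_1,\mathcal U_2,\dots$ of open covers of $Y$ there is a sequence $\mathcal V_1,\mathcal V_2,\dots$ such that each $\mathcal V_i$ is a family of pairwise disjoint open subsets of $Y$ refining $\mathcal U_i$ (every $V\in\mathcal V_i$ lies in some $U\in\mathcal U_i$) and $\bigcup_i\mathcal V_i$ covers $Y$. For a lattice $L$ with least element $0$ and greatest element $1$, the *Wallman space* $wL$ is the set of all ultrafilters (maximal proper filters) on $L$, with the sets $\hat a=\{u\in wL : a\in u\}$, $a\in L$, as a base for the closed sets. For an infinite cardinal $\kappa$, $H(\kappa)$ is the collection of all sets whose transitive closure has cardinality less than $\kappa$. Let $X$ be a compact Hausdorff space, let $2^X$ be the lattice of closed subsets of $X$ (with $\cup$, $\cap$, $\emptyset$, $X$), and let $\kappa$ be a regular cardinal with $\mathcal P(\mathcal P(X))\in H(\kappa)$. Let $\mathcal M\prec H(\kappa)$ be a countable elementary submodel (for the language of set theory) with $X\in\mathcal M$ (the space $X$, i.e. its underlying set together with its topology), and put $L=2^X\cap\mathcal M$. Then 1. $X$ is a C-space if and only if $wL$ is a C-space.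 2. More generally, let $K^*$ be any distributive and separative lattice with $0$ and $1$ such that $K^*\in\mathcal M$ (the underlying set together with the lattice structure), and let $K=K^*\cap\mathcal M$. Then $wK^*$ is a C-space if and only if $wK$ is a C-space. Here $L$ and $K$ carry the order of $2^X$ and $K^*$, respectively, and a lattice is *separative* if for all $a\not\le b$ there is $c\neq 0$ with $c\le a$ and $c\wedge b=0$. -/

import Mathlib

universe u

/-! ### Topology: property C and Wallman spaces -/

/-- `X` is a C-space: for all open covers `𝒰 0, 𝒰 1, …` there are families `𝒱 0, 𝒱 1, …` of
pairwise disjoint open sets such that `𝒱 i` refines `𝒰 i` and `⋃ i, 𝒱 i` covers `X`. -/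
def IsCSpace (X : Type*) [TopologicalSpace X] : Prop :=
  ∀ 𝒰 : ℕ → Set (Set X), (∀ i, (∀ U ∈ 𝒰 i, IsOpen U) ∧ ⋃₀ 𝒰 i = Set.univ) →
    ∃ 𝒱 : ℕ → Set (Set X),
      (∀ i, (∀ V ∈ 𝒱 i, IsOpen V) ∧ (𝒱 i).PairwiseDisjoint id ∧
        ∀ V ∈ 𝒱 i, ∃ U ∈ 𝒰 i, V ⊆ U) ∧
      ⋃ i, ⋃₀ 𝒱 i = Set.univ

/-- A bounded lattice is separative if every `a ≰ b` has a nonzero `c ≤ a` with `c ⊓ b = ⊥`. -/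
def IsSeparative (L : Type*) [Lattice L] [BoundedOrder L] : Prop :=
  ∀ a b : L, ¬ a ≤ b → ∃ c : L, c ≤ a ∧ c ≠ ⊥ ∧ c ⊓ b = ⊥

/-- The points of the Wallman space `wL`: the ultrafilters on `L`, i.e. the maximal proper filters.
A filter is a nonempty, upward closed, downward directed subset; in a lattice, downward directed
means (for an upward closed set) closed under `⊓`, and proper means that `⊥` is not an element.
Only the order of `L` is needed to say this. -/
def Wallman (L : Type*) [PartialOrder L] : Type _ :=
  {u : Order.PFilter L // Maximal (fun F : Order.PFilter L => (F : Set L) ≠ Set.univ) u}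

/-- The set `â` of all ultrafilters that contain `a`. -/
def Wallman.hat {L : Type*} [PartialOrder L] (a : L) : Set (Wallman L) :=
  {u | a ∈ u.1}

/-- The topology of `wL` is the one generated by declaring every `â` closed. For a distributive
lattice the sets `â` are closed under finite unions and intersections, so that they are a base for
the closed sets. -/
instance Wallman.instTopologicalSpace (L : Type*) [PartialOrder L] :
    TopologicalSpace (Wallman L) :=
  TopologicalSpace.generateFrom {U | ∃ a : L, U = (Wallman.hat a)ᶜ}

/-! ### Set theory: `H(κ)` and its elementary submodels

The universe of sets is Mathlib's model `ZFSet` of ZFC. -/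

/-- The transitive closure `x ∪ ⋃ x ∪ ⋃ ⋃ x ∪ …`. -/
noncomputable def ZFSet.transClosure (x : ZFSet.{u}) : ZFSet.{u} :=
  ZFSet.iUnion fun n : ℕ => ZFSet.sUnion^[n] x

/-- `H(κ)`, the collection of all sets whose transitive closure has fewer than `κ` elements. -/
def HSet (κ : Cardinal.{u}) : Set ZFSet.{u} :=
  {x | x.transClosure.card < κ}

/-- The only relation symbol of the language of set theory: a binary one, for membership. -/
inductive MemRel : ℕ → Type
  | mem : MemRel 2

/-- The first-order language of set theory. -/
def setLang : FirstOrder.Language := ⟨fun _ => Empty, MemRel⟩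

/-- A collection of sets as a structure for the language of set theory, with the true `∈`. -/
instance setLangStructure (A : Set ZFSet.{u}) : setLang.Structure A where
  funMap := fun f => f.elim
  RelMap | .mem => fun x => (x 0 : ZFSet.{u}) ∈ (x 1 : ZFSet.{u})

/-- `M ≺ H(κ)`: the collection `M` is (the universe of) an elementary submodel of `H(κ)`. -/
def IsElementarySubmodel (M : Set ZFSet.{u}) (κ : Cardinal.{u}) : Prop :=
  ∃ S : setLang.ElementarySubstructure (HSet κ), Subtype.val '' (S : Set (HSet κ)) = M

/-! ### Spaces and lattices as sets -/

/-- The type of elements of a set `k`. (It does not inherit the inclusion order of `ZFSet`, so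
that `k` can be given its own topology or lattice structure.) -/
def Elements (k : ZFSet.{u}) : Type (u + 1) := {a : ZFSet.{u} // a ∈ k}

/-- The topology on the set `X`, as a set of subsets of `X`. -/
noncomputable def openSets (X : ZFSet.{u}) [TopologicalSpace (Elements X)] : ZFSet.{u} :=
  X.powerset.sep fun U => IsOpen {a : Elements X | a.1 ∈ U}

/-- The topological space `X` as a set, the pair of its underlying set and its topology. -/
noncomputable def spaceCode (X : ZFSet.{u}) [TopologicalSpace (Elements X)] : ZFSet.{u} :=
  ZFSet.pair X (openSets X)

/-- The set `2^X` of all closed subsets of the space `X`. -/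
noncomputable def closedSets (X : ZFSet.{u}) [TopologicalSpace (Elements X)] : ZFSet.{u} :=
  X.powerset.sep fun F => IsClosed {a : Elements X | a.1 ∈ F}

/-- `2^X ∩ M`, the closed subsets of `X` that belong to `M`, ordered by inclusion. -/
abbrev ClosedTrace (X : ZFSet.{u}) [TopologicalSpace (Elements X)] (M : Set ZFSet.{u}) :
    Type (u + 1) :=
  {F : ZFSet.{u} // F ∈ closedSets X ∧ F ∈ M}

/-- The order of `K` as a set of ordered pairs. -/
noncomputable def orderGraph (K : ZFSet.{u}) [PartialOrder (Elements K)] : ZFSet.{u} :=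
  (K.prod K).sep fun p => ∃ a b : Elements K, a ≤ b ∧ p = ZFSet.pair a.1 b.1

/-- The lattice `K` as a set, the pair of its underlying set and its order; the lattice operations
and the bounds are determined by the order (and are first-order definable from it). -/
noncomputable def latticeCode (K : ZFSet.{u}) [PartialOrder (Elements K)] : ZFSet.{u} :=
  ZFSet.pair K (orderGraph K)

/-- `K ∩ M`, the elements of the lattice `K` that belong to `M`, with the order of `K`. -/
abbrev LatticeTrace (K : ZFSet.{u}) [PartialOrder (Elements K)] (M : Set ZFSet.{u}) :
    Type (u + 1) :=
  {a : Elements K // a.1 ∈ M}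

/-!
Property C of a compact space is a property of any lattice base `P` for its closed sets: by
compactness the covers may be taken finite and to consist of complements of members of `P`, and so
may the disjoint families that refine them, finitely many in all. This is `CoverProperty`, a
condition on the order of `P`, and `IsClosedLatticeBase.isCSpace_iff` is the equivalence. It
applies to a space with the lattice of its closed sets and, by separativity, to the Wallman space
of a distributive lattice (`Wallman.isClosedLatticeBase_hat`); the space need not be normal.

It remains to compare `CoverProperty` for a lattice `Λ ⊆ H(κ)`, definable from parameters in an
elementary submodel, and for its trace on the submodel. The trace is a separative sublattice by
elementarity. If `Λ` has the property, so has the trace (`IsDefinableOrder.coverProperty_trace`):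
only finitely many of the given covers matter, and the existence of a finite tuple refining them
is reflected.

For the converse (`IsDefinableOrder.coverProperty_of_trace`) a whole sequence of covers without
disjoint refinements has to be found in the submodel. If `Λ` is finite, the trace is all of `Λ`.
Otherwise `κ` is uncountable, and `H(κ)` contains a code of a bad sequence: an infinite set `I` of
indices together with a set `C` of pairs `(i, a)`, with `a` in the `i`-th cover. Neither functions
nor natural numbers enter; all that has to be definable, besides the order of `Λ`, is the ordered
pair and finiteness, the latter in the form found by Tarski (`HSet.hasFiniteExtent_iff`). By
elementarity such `I` and `C` exist in the submodel. Infinitely many indices then lie in the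
submodel, their covers have finite subcovers there, whose elements also lie there, and disjoint
refinements of these in the trace would contradict the choice of `C`.
-/

/-! ### The cover property of an ordered set -/

/-- The C-property of a compact space, read off from a lattice `P` that is a base for its closed
sets. A finite `A ⊆ P` whose only lower bound is the bottom stands for the open cover by the
complements of its elements, and `B` collects the complements of the members of all the disjoint
families, each tagged with its index. Only the order of `P` is used. -/
def CoverProperty (P : Type*) [PartialOrder P] : Prop :=
  ∀ A : ℕ → Finset P, (∀ i x, (∀ a ∈ A i, x ≤ a) → IsBot x) →
    ∃ B : Finset (ℕ × P),
      (∀ p ∈ B, ∃ a ∈ A p.1, a ≤ p.2) ∧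
      (∀ p ∈ B, ∀ q ∈ B, p.1 = q.1 → p.2 = q.2 ∨ ∀ x, p.2 ≤ x → q.2 ≤ x → IsTop x) ∧
      ∀ x, (∀ p ∈ B, x ≤ p.2) → IsBot x

theorem OrderIso.isBot_apply {P Q : Type*} [PartialOrder P] [PartialOrder Q] (e : P ≃o Q) {x : P} :
    IsBot (e x) ↔ IsBot x :=
  ⟨fun h y => e.le_iff_le.1 (h (e y)), fun h y => by simpa using e.le_iff_le.2 (h (e.symm y))⟩

theorem OrderIso.isTop_apply {P Q : Type*} [PartialOrder P] [PartialOrder Q] (e : P ≃o Q) {x : P} :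
    IsTop (e x) ↔ IsTop x :=
  ⟨fun h y => e.le_iff_le.1 (h (e y)), fun h y => by simpa using e.le_iff_le.2 (h (e.symm y))⟩

theorem CoverProperty.of_orderIso {P Q : Type*} [PartialOrder P] [PartialOrder Q] (e : P ≃o Q)
    (h : CoverProperty P) : CoverProperty Q := by
  classical
  intro A hA
  obtain ⟨B, h1, h2, h3⟩ := h (fun i => (A i).image e.symm) (by
    intro i x hx
    rw [← e.isBot_apply]
    refine hA i _ fun a ha => ?_
    have := hx (e.symm a) (Finset.mem_image_of_mem _ ha)
    simpa using e.le_iff_le.2 this)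
  refine ⟨B.image fun p => (p.1, e p.2), ?_, ?_, ?_⟩
  · simp only [Finset.forall_mem_image]
    intro p hp
    obtain ⟨a, ha, hap⟩ := h1 p hp
    obtain ⟨c, hc, rfl⟩ := Finset.mem_image.1 ha
    exact ⟨c, hc, by simpa using e.le_iff_le.2 hap⟩
  · simp only [Finset.forall_mem_image]
    intro p hp q hq hpq
    refine (h2 p hp q hq hpq).imp (congrArg e) fun h x hpx hqx => ?_
    have := h (e.symm x) (e.le_symm_apply.2 hpx) (e.le_symm_apply.2 hqx)
    simpa using e.isTop_apply.2 this
  · simp only [Finset.forall_mem_image]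
    intro x hx
    have := h3 (e.symm x) fun p hp => e.symm_apply_le.2 (hx hp)
    simpa using e.isBot_apply.2 this

theorem OrderIso.coverProperty_iff {P Q : Type*} [PartialOrder P] [PartialOrder Q] (e : P ≃o Q) :
    CoverProperty P ↔ CoverProperty Q :=
  ⟨.of_orderIso e, .of_orderIso e.symm⟩

/-! ### Compact spaces with a lattice base for the closed sets -/

/-- A lattice of closed subsets of `Y`, indexed by `P`, that is a base for the closed sets. -/
structure IsClosedLatticeBase {P Y : Type*} [Lattice P] [BoundedOrder P] [TopologicalSpace Y]
    (h : P → Set Y) : Prop where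
  isClosed : ∀ a, IsClosed (h a)
  subset_iff : ∀ a b, h a ⊆ h b ↔ a ≤ b
  map_bot : h ⊥ = ∅
  map_top : h ⊤ = Set.univ
  map_inf : ∀ a b, h (a ⊓ b) = h a ∩ h b
  map_sup : ∀ a b, h (a ⊔ b) = h a ∪ h b
  exists_compl_subset : ∀ (y : Y) (U : Set Y), IsOpen U → y ∈ U → ∃ a, y ∉ h a ∧ (h a)ᶜ ⊆ U

namespace IsClosedLatticeBase

variable {P Y : Type*} [Lattice P] [BoundedOrder P] [TopologicalSpace Y] {h : P → Set Y}

theorem mem_finset_inf (H : IsClosedLatticeBase h) {ι : Type*} (s : Finset ι) (f : ι → P) (y : Y) :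
    y ∈ h (s.inf f) ↔ ∀ i ∈ s, y ∈ h (f i) := by
  classical
  induction s using Finset.induction_on with
  | empty => simp [H.map_top]
  | insert a s _ ih => simp [Finset.inf_insert, H.map_inf, ih]

theorem isBot_of_eq_empty (H : IsClosedLatticeBase h) {a : P} (ha : h a = ∅) : IsBot a := fun b =>
  (H.subset_iff a b).1 (by simp [ha])

theorem isTop_of_eq_univ (H : IsClosedLatticeBase h) {a : P} (ha : h a = Set.univ) : IsTop a :=
  fun b => (H.subset_iff b a).1 (by simp [ha])

/-- A finite set with trivial lower bounds has empty intersection in `Y`. -/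
theorem exists_notMem (H : IsClosedLatticeBase h) {ι : Type*} (s : Finset ι) (f : ι → P)
    (hs : ∀ x, (∀ i ∈ s, x ≤ f i) → IsBot x) (y : Y) : ∃ i ∈ s, y ∉ h (f i) := by
  by_contra! hy
  have hbot : s.inf f = ⊥ := (hs _ fun i hi => Finset.inf_le hi).eq_bot
  have : y ∈ h (s.inf f) := (H.mem_finset_inf s f y).2 hy
  simp [hbot, H.map_bot] at this

/-- By compactness, the disjoint families of a C-space may be taken finite and to consist of
complements of members of the lattice base. -/
theorem coverProperty_of_isCSpace [CompactSpace Y] (H : IsClosedLatticeBase h)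
    (hC : IsCSpace Y) : CoverProperty P := by
  classical
  intro A hA
  obtain ⟨𝒱, h𝒱, hcov⟩ := hC (fun i => {U | ∃ a ∈ A i, U = (h a)ᶜ}) (by
    refine fun i => ⟨?_, ?_⟩
    · rintro _ ⟨a, -, rfl⟩
      exact (H.isClosed a).isOpen_compl
    · refine Set.eq_univ_of_forall fun y => ?_
      obtain ⟨a, ha, hya⟩ := H.exists_notMem (A i) id (hA i) y
      exact ⟨_, ⟨a, ha, rfl⟩, hya⟩)
  have hpt : ∀ y : Y, ∃ t : (ℕ × Set Y) × P, t.1.2 ∈ 𝒱 t.1.1 ∧ y ∉ h t.2 ∧ (h t.2)ᶜ ⊆ t.1.2 := by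
    intro y
    have hy : y ∈ ⋃ i, ⋃₀ 𝒱 i := hcov ▸ Set.mem_univ y
    obtain ⟨i, V, hV, hyV⟩ := Set.mem_iUnion.1 hy
    obtain ⟨b, hyb, hbV⟩ := H.exists_compl_subset y V ((h𝒱 i).1 V hV) hyV
    exact ⟨((i, V), b), hV, hyb, hbV⟩
  choose t ht𝒱 hty htV using hpt
  obtain ⟨s, hs⟩ := CompactSpace.elim_nhds_subcover (fun y => (h (t y).2)ᶜ)
    fun y => (H.isClosed _).isOpen_compl.mem_nhds (hty y)
  -- the complement of `b iV` is the union of the chosen basic open sets below the member `iV.2`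
  let b : ℕ × Set Y → P := fun iV => (s.filter fun y => (t y).1 = iV).inf fun y => (t y).2
  have hbV : ∀ iV, (h (b iV))ᶜ ⊆ iV.2 := by
    intro iV y hy
    rw [Set.mem_compl_iff, H.mem_finset_inf] at hy
    push Not at hy
    obtain ⟨z, hz, hyz⟩ := hy
    obtain ⟨-, rfl⟩ := Finset.mem_filter.1 hz
    exact htV z hyz
  refine ⟨(s.image fun y => (t y).1).image fun iV => (iV.1, b iV), ?_, ?_, ?_⟩
  · simp only [Finset.forall_mem_image]
    intro y hy
    obtain ⟨_, ⟨a, ha, rfl⟩, hVa⟩ := (h𝒱 _).2.2 _ (ht𝒱 y)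
    exact ⟨a, ha, (H.subset_iff _ _).1 (Set.compl_subset_compl.1 ((hbV _).trans hVa))⟩
  · simp only [Finset.forall_mem_image]
    intro y hy z hz hyz
    by_cases hV : (t y).1.2 = (t z).1.2
    · exact Or.inl (congrArg b (Prod.ext hyz hV))
    · refine Or.inr fun x hyx hzx => H.isTop_of_eq_univ (Set.eq_univ_of_forall fun w => ?_)
      have hdis : Disjoint (t y).1.2 (t z).1.2 :=
        (h𝒱 (t y).1.1).2.1 (ht𝒱 y) (by simpa only [hyz] using ht𝒱 z) hV
      by_contra hw
      exact Set.disjoint_left.1 hdis (hbV _ fun h' => hw ((H.subset_iff _ _).2 hyx h'))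
        (hbV _ fun h' => hw ((H.subset_iff _ _).2 hzx h'))
  · simp only [Finset.forall_mem_image]
    intro x hx
    refine H.isBot_of_eq_empty (Set.eq_empty_of_forall_notMem fun w hw => ?_)
    have hws : w ∈ ⋃ y ∈ s, (h (t y).2)ᶜ := hs ▸ Set.mem_univ w
    obtain ⟨y, hy, hwy⟩ := Set.mem_iUnion₂.1 hws
    have h1 := (H.subset_iff _ _).2 (hx hy) hw
    exact hwy ((H.mem_finset_inf _ _ _).1 h1 y (by simp [hy]))

theorem isCSpace_of_coverProperty [CompactSpace Y] (H : IsClosedLatticeBase h)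
    (hP : CoverProperty P) : IsCSpace Y := by
  classical
  intro 𝒰 h𝒰
  have hpt : ∀ i, ∃ A : Finset P, (∀ a ∈ A, ∃ U ∈ 𝒰 i, (h a)ᶜ ⊆ U) ∧
      ∀ y : Y, ∃ a ∈ A, y ∉ h a := by
    intro i
    have : ∀ y : Y, ∃ a : P, y ∉ h a ∧ ∃ U ∈ 𝒰 i, (h a)ᶜ ⊆ U := by
      intro y
      obtain ⟨U, hU, hyU⟩ : y ∈ ⋃₀ 𝒰 i := (h𝒰 i).2 ▸ Set.mem_univ y
      obtain ⟨a, hya, haU⟩ := H.exists_compl_subset y U ((h𝒰 i).1 U hU) hyU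
      exact ⟨a, hya, U, hU, haU⟩
    choose a hya haU using this
    obtain ⟨s, hs⟩ := CompactSpace.elim_nhds_subcover (fun y => (h (a y))ᶜ)
      fun y => (H.isClosed _).isOpen_compl.mem_nhds (hya y)
    refine ⟨s.image a, ?_, fun y => ?_⟩
    · simp only [Finset.forall_mem_image]
      exact fun y _ => haU y
    · have hys : y ∈ ⋃ z ∈ s, (h (a z))ᶜ := hs ▸ Set.mem_univ y
      obtain ⟨z, hz, hyz⟩ := Set.mem_iUnion₂.1 hys
      exact ⟨a z, Finset.mem_image_of_mem a hz, hyz⟩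
  choose A hAU hA using hpt
  obtain ⟨B, h1, h2, h3⟩ := hP A (by
    intro i x hx
    refine H.isBot_of_eq_empty (Set.eq_empty_of_forall_notMem fun w hw => ?_)
    obtain ⟨a, ha, hwa⟩ := hA i w
    exact hwa ((H.subset_iff _ _).2 (hx a ha) hw))
  refine ⟨fun i => {V | ∃ b, (i, b) ∈ B ∧ V = (h b)ᶜ}, fun i => ⟨?_, ?_, ?_⟩, ?_⟩
  · rintro _ ⟨b, -, rfl⟩
    exact (H.isClosed b).isOpen_compl
  · rintro _ ⟨b, hb, rfl⟩ _ ⟨c, hc, rfl⟩ hne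
    rcases h2 _ hb _ hc rfl with hbc | hbc
    · exact absurd (congrArg (fun d => (h d)ᶜ) hbc) hne
    · have htop : b ⊔ c = ⊤ := (hbc _ le_sup_left le_sup_right).eq_top
      have huniv : h b ∪ h c = Set.univ := by rw [← H.map_sup, htop, H.map_top]
      refine Set.disjoint_left.2 fun w hwb hwc => ?_
      have hw : w ∈ h b ∪ h c := huniv ▸ Set.mem_univ w
      exact hw.elim hwb hwc
  · rintro _ ⟨b, hb, rfl⟩
    obtain ⟨a, ha, hab⟩ := h1 _ hb
    obtain ⟨U, hU, haU⟩ := hAU i a ha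
    exact ⟨U, hU, (Set.compl_subset_compl.2 ((H.subset_iff _ _).2 hab)).trans haU⟩
  · refine Set.eq_univ_of_forall fun y => ?_
    obtain ⟨p, hp, hyp⟩ := H.exists_notMem B Prod.snd h3 y
    exact Set.mem_iUnion.2 ⟨p.1, _, ⟨p.2, hp, rfl⟩, hyp⟩

theorem isCSpace_iff [CompactSpace Y] (H : IsClosedLatticeBase h) :
    IsCSpace Y ↔ CoverProperty P :=
  ⟨H.coverProperty_of_isCSpace, H.isCSpace_of_coverProperty⟩

end IsClosedLatticeBase

theorem TopologicalSpace.Closeds.isClosedLatticeBase (Y : Type*) [TopologicalSpace Y] :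
    IsClosedLatticeBase (fun F : TopologicalSpace.Closeds Y => (F : Set Y)) where
  isClosed F := F.isClosed
  subset_iff _ _ := Iff.rfl
  map_bot := rfl
  map_top := rfl
  map_inf _ _ := rfl
  map_sup _ _ := rfl
  exists_compl_subset y U hU hy := ⟨⟨Uᶜ, hU.isClosed_compl⟩, by simpa using hy, by simp⟩

theorem isSeparative_closeds (Y : Type*) [TopologicalSpace Y] [T1Space Y] :
    IsSeparative (TopologicalSpace.Closeds Y) := by
  intro F G hFG
  obtain ⟨y, hyF, hyG⟩ := Set.not_subset.1 hFG
  refine ⟨⟨{y}, isClosed_singleton⟩, ?_, fun h => ?_, ?_⟩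
  · exact Set.singleton_subset_iff.2 hyF
  · have : ({y} : Set Y) = ∅ := congrArg (fun K : TopologicalSpace.Closeds Y => (K : Set Y)) h
    simp at this
  · refine TopologicalSpace.Closeds.ext ?_
    exact Set.singleton_inter_eq_empty.2 hyG

/-! ### The Wallman space of a separative distributive lattice -/

namespace Wallman

theorem isClosed_hat {P : Type*} [PartialOrder P] (a : P) : IsClosed (hat a) :=
  ⟨TopologicalSpace.isOpen_generateFrom_of_mem ⟨a, rfl⟩⟩

theorem hat_inf {P : Type*} [DistribLattice P] (a b : P) : hat (a ⊓ b) = hat a ∩ hat b := by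
  ext u
  exact ⟨fun h => ⟨u.1.mem_of_le inf_le_left h, u.1.mem_of_le inf_le_right h⟩,
    fun h => Order.PFilter.inf_mem h.1 h.2⟩

variable {P : Type*} [DistribLattice P] [BoundedOrder P]

theorem coe_ne_univ_iff {F : Order.PFilter P} : (F : Set P) ≠ Set.univ ↔ ⊥ ∉ F := by
  refine not_congr ⟨fun h => ?_, fun h => ?_⟩
  · exact (Set.ext_iff.1 h ⊥).2 trivial
  · exact Set.eq_univ_of_forall fun a => F.mem_of_le bot_le h

/-- The filter whose underlying set is `s`. -/
def pfilterOfSet (s : Set P) (hs : ⊤ ∈ s) (hinf : ∀ a ∈ s, ∀ b ∈ s, a ⊓ b ∈ s)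
    (hup : ∀ a b, a ≤ b → a ∈ s → b ∈ s) : Order.PFilter P :=
  Order.IsPFilter.toPFilter (F := s) (.of_def ⟨⊤, hs⟩
    (fun a ha b hb => ⟨a ⊓ b, hinf a ha b hb, inf_le_left, inf_le_right⟩) fun {a b} => hup a b)

/-- Every proper filter extends to an ultrafilter, by Zorn's lemma. -/
theorem exists_le (F : Order.PFilter P) (hF : ⊥ ∉ F) : ∃ u : Wallman P, F ≤ u.1 := by
  obtain ⟨m, hFm, hm⟩ := zorn_le_nonempty₀ {F : Order.PFilter P | (F : Set P) ≠ Set.univ} (by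
    intro c hc hchain y hy
    refine ⟨pfilterOfSet {a | ∃ G ∈ c, a ∈ G} ⟨y, hy, Order.PFilter.top_mem⟩ ?_ ?_, ?_, ?_⟩
    · rintro a ⟨G, hG, haG⟩ b ⟨G', hG', hbG'⟩
      rcases hchain.total hG hG' with hle | hle
      · exact ⟨G', hG', Order.PFilter.inf_mem (hle haG) hbG'⟩
      · exact ⟨G, hG, Order.PFilter.inf_mem haG (hle hbG')⟩
    · rintro a b hab ⟨G, hG, haG⟩
      exact ⟨G, hG, G.mem_of_le hab haG⟩
    · refine coe_ne_univ_iff.2 ?_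
      rintro ⟨G, hG, hbot⟩
      exact coe_ne_univ_iff.1 (hc hG) hbot
    · exact fun G hG a ha => ⟨G, hG, ha⟩) F (coe_ne_univ_iff.2 hF)
  exact ⟨⟨m, hm⟩, hFm⟩

/-- An element that meets every member of an ultrafilter belongs to it. -/
theorem mem_of_forall_inf_ne_bot (u : Wallman P) {a : P} (ha : ∀ b ∈ u.1, b ⊓ a ≠ ⊥) :
    a ∈ u.1 := by
  let G := pfilterOfSet {c | ∃ b ∈ u.1, b ⊓ a ≤ c} ⟨⊤, Order.PFilter.top_mem, le_top⟩
    (by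
      rintro c ⟨b, hb, hc⟩ d ⟨b', hb', hd⟩
      exact ⟨b ⊓ b', Order.PFilter.inf_mem hb hb',
        le_inf ((inf_le_inf_right _ inf_le_left).trans hc)
          ((inf_le_inf_right _ inf_le_right).trans hd)⟩)
    (by
      rintro c d hcd ⟨b, hb, hc⟩
      exact ⟨b, hb, hc.trans hcd⟩)
  have hG : (G : Set P) ≠ Set.univ := by
    rw [coe_ne_univ_iff]
    rintro ⟨b, hb, hle⟩
    exact ha b hb (le_bot_iff.1 hle)
  have huG : u.1 ≤ G := fun b hb => ⟨b, hb, inf_le_left⟩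
  exact u.2.2 hG huG ⟨⊤, Order.PFilter.top_mem, inf_le_right⟩

theorem bot_notMem (u : Wallman P) : ⊥ ∉ u.1 := coe_ne_univ_iff.1 u.2.1

/-- In a distributive lattice, ultrafilters are prime. -/
theorem sup_mem_iff (u : Wallman P) (a b : P) : a ⊔ b ∈ u.1 ↔ a ∈ u.1 ∨ b ∈ u.1 := by
  refine ⟨fun h => ?_, ?_⟩
  · by_contra! hab
    have key : ∀ c, c ∉ u.1 → ∃ d ∈ u.1, d ⊓ c = ⊥ := by
      intro c hc
      by_contra! hd
      exact hc (u.mem_of_forall_inf_ne_bot hd)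
    obtain ⟨d, hd, hda⟩ := key a hab.1
    obtain ⟨e, he, heb⟩ := key b hab.2
    refine u.bot_notMem ?_
    have : (d ⊓ e) ⊓ (a ⊔ b) = ⊥ := by
      rw [inf_sup_left, sup_eq_bot_iff]
      exact ⟨le_bot_iff.1 (hda ▸ inf_le_inf_right a inf_le_left),
        le_bot_iff.1 (heb ▸ inf_le_inf_right b inf_le_right)⟩
    rw [← this]
    exact Order.PFilter.inf_mem (Order.PFilter.inf_mem hd he) h
  · rintro (h | h)
    · exact u.1.mem_of_le le_sup_left h
    · exact u.1.mem_of_le le_sup_right h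

theorem hat_sup (a b : P) : hat (a ⊔ b) = hat a ∪ hat b := by
  ext u
  exact u.sup_mem_iff a b

theorem hat_bot : hat (⊥ : P) = ∅ :=
  Set.eq_empty_of_forall_notMem fun u => u.bot_notMem

theorem hat_top : hat (⊤ : P) = Set.univ :=
  Set.eq_univ_of_forall fun _ => Order.PFilter.top_mem

theorem isTopologicalBasis :
    TopologicalSpace.IsTopologicalBasis {U : Set (Wallman P) | ∃ a : P, U = (hat a)ᶜ} where
  exists_subset_inter := by
    rintro _ ⟨a, rfl⟩ _ ⟨b, rfl⟩ u hu
    rw [← Set.compl_union, ← hat_sup] at hu ⊢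
    exact ⟨_, ⟨_, rfl⟩, hu, subset_rfl⟩
  sUnion_eq := Set.eq_univ_of_forall fun u => ⟨_, ⟨⊥, rfl⟩, u.bot_notMem⟩
  eq_generateFrom := rfl

theorem hat_subset_hat_iff (hP : IsSeparative P) (a b : P) : hat a ⊆ hat b ↔ a ≤ b := by
  refine ⟨fun h => ?_, fun h u hu => u.1.mem_of_le h hu⟩
  by_contra hab
  obtain ⟨c, hca, hc, hcb⟩ := hP a b hab
  obtain ⟨u, hu⟩ := exists_le (Order.PFilter.principal c) fun h => hc (le_bot_iff.1 h)
  have hcu : c ∈ u.1 := hu (Order.PFilter.mem_principal.2 le_rfl)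
  refine u.bot_notMem ?_
  rw [← hcb]
  exact Order.PFilter.inf_mem hcu (h (u.1.mem_of_le hca hcu))

/-- An ultrafilter `𝓕` on the set `wP` converges to any point of `wP` above the filter of all `a`
with `â ∈ 𝓕`. -/
instance instCompactSpace : CompactSpace (Wallman P) := by
  refine ⟨isCompact_iff_ultrafilter_le_nhds.2 fun 𝓕 _ => ?_⟩
  let F : Order.PFilter P := pfilterOfSet {a | hat a ∈ 𝓕}
    (by
      show hat ⊤ ∈ 𝓕
      rw [hat_top]
      exact Filter.univ_mem)
    (fun a ha b hb => by
      show hat (a ⊓ b) ∈ 𝓕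
      rw [hat_inf]
      exact Filter.inter_mem ha hb)
    (fun a b hab ha => Filter.mem_of_superset ha fun u hu => u.1.mem_of_le hab hu)
  have hF : ⊥ ∉ F := by
    intro h
    have : hat (⊥ : P) ∈ 𝓕 := h
    rw [hat_bot] at this
    exact 𝓕.empty_notMem this
  obtain ⟨u, hu⟩ := exists_le F hF
  refine ⟨u, Set.mem_univ u, ?_⟩
  rw [isTopologicalBasis.nhds_hasBasis.ge_iff]
  rintro _ ⟨⟨a, rfl⟩, hua⟩
  exact Ultrafilter.compl_mem_iff_notMem.2 fun ha => hua (hu ha)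

theorem isClosedLatticeBase_hat (hP : IsSeparative P) : IsClosedLatticeBase (hat (L := P)) where
  isClosed := isClosed_hat
  subset_iff := hat_subset_hat_iff hP
  map_bot := hat_bot
  map_top := hat_top
  map_inf := hat_inf
  map_sup := hat_sup
  exists_compl_subset u U hU hu := by
    obtain ⟨_, ⟨a, rfl⟩, hua, haU⟩ := isTopologicalBasis.exists_subset_of_mem_open hu hU
    exact ⟨a, hua, haU⟩

theorem isCSpace_iff (hP : IsSeparative P) : IsCSpace (Wallman P) ↔ CoverProperty P :=
  (isClosedLatticeBase_hat hP).isCSpace_iff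

end Wallman

/-- The lattice structure of `Q`, transported to the order `P`; the order of `P` is kept. -/
abbrev OrderIso.distribLattice {P Q : Type*} [inst : PartialOrder P] [DistribLattice Q]
    (e : P ≃o Q) : DistribLattice P where
  toPartialOrder := inst
  sup a b := e.symm (e a ⊔ e b)
  inf a b := e.symm (e a ⊓ e b)
  le_sup_left a b := e.le_symm_apply.2 le_sup_left
  le_sup_right a b := e.le_symm_apply.2 le_sup_right
  sup_le a b c hac hbc := e.symm_apply_le.2 (sup_le (e.le_iff_le.2 hac) (e.le_iff_le.2 hbc))
  inf_le_left a b := e.symm_apply_le.2 inf_le_left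
  inf_le_right a b := e.symm_apply_le.2 inf_le_right
  le_inf a b c hab hac := e.le_symm_apply.2 (le_inf (e.le_iff_le.2 hab) (e.le_iff_le.2 hac))
  le_sup_inf a b c := e.le_iff_le.1 (by
    show e (e.symm (e (e.symm _) ⊓ e (e.symm _))) ≤ e (e.symm (e _ ⊔ e (e.symm _)))
    simpa only [e.apply_symm_apply] using le_sup_inf)

theorem Wallman.isCSpace_iff_of_orderIso {P Q : Type*} [PartialOrder P] [DistribLattice Q]
    [BoundedOrder Q] (hQ : IsSeparative Q) (e : P ≃o Q) :
    IsCSpace (Wallman P) ↔ CoverProperty Q := by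
  let _ : DistribLattice P := e.distribLattice
  let _ : BoundedOrder P :=
    { top := e.symm ⊤
      bot := e.symm ⊥
      le_top := fun a => e.le_symm_apply.2 le_top
      bot_le := fun a => e.symm_apply_le.2 bot_le }
  have hP : IsSeparative P := by
    intro a b hab
    obtain ⟨c, hca, hc, hcb⟩ := hQ (e a) (e b) fun h => hab (e.le_iff_le.1 h)
    refine ⟨e.symm c, e.symm_apply_le.2 hca, fun h => hc (e.symm.injective h), ?_⟩
    show e.symm (e (e.symm c) ⊓ e b) = e.symm ⊥
    rw [e.apply_symm_apply, hcb]
  exact (Wallman.isCSpace_iff hP).trans e.coverProperty_iff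

/-! ### The collection `H(κ)` -/

namespace ZFSet

theorem mem_transClosure {x y : ZFSet.{u}} :
    y ∈ x.transClosure ↔ ∃ n : ℕ, y ∈ ZFSet.sUnion^[n] x := by
  rw [transClosure, mem_iUnion]

theorem subset_transClosure (x : ZFSet.{u}) : x ⊆ x.transClosure := fun _ hy =>
  mem_transClosure.2 ⟨0, hy⟩

theorem transClosure_mono {x y : ZFSet.{u}} (h : x ⊆ y) : x.transClosure ⊆ y.transClosure := by
  intro z hz
  obtain ⟨n, hn⟩ := mem_transClosure.1 hz
  refine mem_transClosure.2 ⟨n, ?_⟩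
  induction n generalizing z with
  | zero => exact h hn
  | succ n ih =>
    rw [Function.iterate_succ_apply', mem_sUnion] at hn ⊢
    obtain ⟨w, hw, hzw⟩ := hn
    exact ⟨w, ih (mem_transClosure.2 ⟨n, hw⟩) hw, hzw⟩

theorem transClosure_subset_of_mem {x y : ZFSet.{u}} (h : y ∈ x) :
    y.transClosure ⊆ x.transClosure := by
  refine Set.Subset.trans (transClosure_mono (y := ⋃₀ x) fun z hz => mem_sUnion_of_mem hz h) ?_
  intro z hz
  obtain ⟨n, hn⟩ := mem_transClosure.1 hz
  exact mem_transClosure.2 ⟨n + 1, hn⟩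

theorem mem_or_of_mem_transClosure {x z : ZFSet.{u}} (h : z ∈ x.transClosure) :
    z ∈ x ∨ ∃ y ∈ x, z ∈ y.transClosure := by
  obtain ⟨n, hn⟩ := mem_transClosure.1 h
  induction n generalizing z with
  | zero => exact Or.inl hn
  | succ n ih =>
    rw [Function.iterate_succ_apply', mem_sUnion] at hn
    obtain ⟨w, hw, hzw⟩ := hn
    rcases ih (mem_transClosure.2 ⟨n, hw⟩) hw with h | ⟨y, hy, hwy⟩
    · exact Or.inr ⟨w, h, subset_transClosure w hzw⟩
    · obtain ⟨m, hm⟩ := mem_transClosure.1 hwy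
      refine Or.inr ⟨y, hy, mem_transClosure.2 ⟨m + 1, ?_⟩⟩
      rw [Function.iterate_succ_apply', mem_sUnion]
      exact ⟨w, hm, hzw⟩

end ZFSet

namespace HSet

variable {κ : Cardinal.{u}}

theorem mem_of_mem {x y : ZFSet.{u}} (hx : x ∈ HSet κ) (hy : y ∈ x) : y ∈ HSet κ :=
  (ZFSet.card_mono (ZFSet.transClosure_subset_of_mem hy)).trans_lt hx

theorem mem_of_subset {x y : ZFSet.{u}} (hx : x ∈ HSet κ) (hy : y ⊆ x) : y ∈ HSet κ :=
  (ZFSet.card_mono (ZFSet.transClosure_mono hy)).trans_lt hx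

theorem card_lt {x : ZFSet.{u}} (hx : x ∈ HSet κ) : x.card < κ :=
  (ZFSet.card_mono (ZFSet.subset_transClosure x)).trans_lt hx

theorem aleph0_lt_of_infinite {x : ZFSet.{u}} (hx : x ∈ HSet κ) (h : (x : Set ZFSet.{u}).Infinite) :
    Cardinal.aleph0 < κ := by
  refine lt_of_le_of_lt ?_ (card_lt hx)
  have := Set.infinite_coe_iff.2 h
  rw [← Cardinal.lift_le.{u + 1}, ← ZFSet.cardinalMk_coe_sort, Cardinal.lift_aleph0]
  exact Cardinal.aleph0_le_mk _

/-- For regular `κ`, a set with fewer than `κ` elements, all of them in `H(κ)`, is in `H(κ)`. -/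
theorem range_mem (hκ : κ.IsRegular) {ι : Type u} (hι : Cardinal.mk ι < κ) (f : ι → ZFSet.{u})
    (hf : ∀ i, f i ∈ HSet κ) : ZFSet.range f ∈ HSet κ := by
  have hsub : (ZFSet.range f).transClosure ⊆
      ZFSet.range f ∪ ZFSet.iUnion fun i => (f i).transClosure := by
    intro z hz
    rw [ZFSet.mem_union]
    refine (ZFSet.mem_or_of_mem_transClosure hz).imp_right ?_
    rintro ⟨y, hy, hzy⟩
    obtain ⟨i, rfl⟩ := ZFSet.mem_range.1 hy
    exact ZFSet.mem_iUnion.2 ⟨i, hzy⟩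
  refine (ZFSet.card_mono hsub).trans_lt (ZFSet.card_union_le.trans_lt ?_)
  refine Cardinal.add_lt_of_lt hκ.aleph0_le ?_ ?_
  · have := ZFSet.lift_card_range_le (f := f)
    rw [Cardinal.lift_id, Cardinal.lift_id] at this
    exact this.trans_lt hι
  · have := ZFSet.lift_card_iUnion_le_sum_card (f := fun i => (f i).transClosure)
    rw [Cardinal.lift_id] at this
    exact this.trans_lt (Cardinal.sum_lt_of_isRegular hκ hι hf)

theorem exists_mem_iff_range (hκ : κ.IsRegular) {ι : Type}
    (hι : Cardinal.lift.{u} (Cardinal.mk ι) < κ) (f : ι → HSet κ) :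
    ∃ z : HSet κ, ∀ x : HSet κ, x.1 ∈ z.1 ↔ x ∈ Set.range f := by
  refine ⟨⟨_, range_mem hκ (ι := ULift.{u} ι) (by simpa using hι) (fun i => (f i.down).1)
    fun i => (f i.down).2⟩, fun x => ?_⟩
  rw [ZFSet.mem_range]
  exact ⟨fun ⟨i, hi⟩ => ⟨i.down, Subtype.ext hi⟩, fun ⟨i, hi⟩ => ⟨⟨i⟩, congrArg _ hi⟩⟩

theorem exists_mem_iff_of_finite (hκ : κ.IsRegular) {s : Set (HSet κ)} (hs : s.Finite) :
    ∃ z : HSet κ, ∀ x : HSet κ, x.1 ∈ z.1 ↔ x ∈ s := by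
  obtain ⟨n, f, -, rfl⟩ := hs.fin_param
  exact exists_mem_iff_range hκ
    (by simpa using Cardinal.natCast_lt_aleph0.trans_le hκ.aleph0_le) f

theorem exists_mem_iff_of_countable (hκ : κ.IsRegular) (hω : Cardinal.aleph0 < κ)
    {s : Set (HSet κ)} (hs : s.Countable) :
    ∃ z : HSet κ, ∀ x : HSet κ, x.1 ∈ z.1 ↔ x ∈ s := by
  rcases s.eq_empty_or_nonempty with rfl | hne
  · exact exists_mem_iff_of_finite hκ Set.finite_empty
  · obtain ⟨f, rfl⟩ := hs.exists_eq_range hne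
    exact exists_mem_iff_range hκ (by simpa using hω) f

theorem eq_iff_forall {q : HSet κ} {t : ZFSet.{u}} (ht : ∀ z ∈ t, z ∈ HSet κ) :
    q.1 = t ↔ ∀ z : HSet κ, z.1 ∈ q.1 ↔ z.1 ∈ t := by
  refine ⟨fun h z => by rw [h], fun h => ZFSet.ext fun z => ⟨fun hz => ?_, fun hz => ?_⟩⟩
  · exact (h ⟨z, mem_of_mem q.2 hz⟩).1 hz
  · exact (h ⟨z, ht z hz⟩).2 hz

theorem upair_mem (hκ : κ.IsRegular) {x y : ZFSet.{u}} (hx : x ∈ HSet κ) (hy : y ∈ HSet κ) :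
    ({x, y} : ZFSet) ∈ HSet κ := by
  obtain ⟨z, hz⟩ := exists_mem_iff_of_finite hκ (Set.toFinite {(⟨x, hx⟩ : HSet κ), ⟨y, hy⟩})
  have : z.1 = {x, y} := by
    refine (eq_iff_forall ?_).2 fun w => ?_
    · intro w hw
      rcases ZFSet.mem_pair.1 hw with rfl | rfl <;> assumption
    · rw [hz, ZFSet.mem_pair]
      simp [Subtype.ext_iff]
  exact this ▸ z.2

theorem singleton_mem (hκ : κ.IsRegular) {x : ZFSet.{u}} (hx : x ∈ HSet κ) :
    ({x} : ZFSet) ∈ HSet κ :=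
  mem_of_subset (upair_mem hκ hx hx) fun w hw => by
    rw [ZFSet.mem_pair]
    exact Or.inl (ZFSet.mem_singleton.1 hw)

theorem pair_mem (hκ : κ.IsRegular) {x y : ZFSet.{u}} (hx : x ∈ HSet κ) (hy : y ∈ HSet κ) :
    ZFSet.pair x y ∈ HSet κ :=
  upair_mem hκ (singleton_mem hκ hx) (upair_mem hκ hx hy)

theorem fst_mem {x y : ZFSet.{u}} (h : ZFSet.pair x y ∈ HSet κ) : x ∈ HSet κ :=
  mem_of_mem (mem_of_mem h (ZFSet.mem_pair.2 (Or.inl rfl))) (ZFSet.mem_singleton.2 rfl)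

theorem snd_mem {x y : ZFSet.{u}} (h : ZFSet.pair x y ∈ HSet κ) : y ∈ HSet κ :=
  mem_of_mem (mem_of_mem h (ZFSet.mem_pair.2 (Or.inr rfl))) (ZFSet.mem_pair.2 (Or.inr rfl))

/-- The ordered pair, as an operation on `H(κ)`. -/
noncomputable def pair (hκ : κ.IsRegular) (x y : HSet κ) : HSet κ :=
  ⟨ZFSet.pair x.1 y.1, pair_mem hκ x.2 y.2⟩

/-- `x` has finitely many elements. -/
def HasFiniteExtent (x : HSet κ) : Prop := {y : HSet κ | y.1 ∈ x.1}.Finite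

/-- Tarski's characterization of finiteness, which needs no functions or natural numbers. An
infinite element of `H(κ)` forces `ℵ₀ < κ`, so that a strictly decreasing sequence of its subsets
belongs to `H(κ)`. -/
theorem hasFiniteExtent_iff (hκ : κ.IsRegular) (x : HSet κ) :
    HasFiniteExtent x ↔ ∀ F : HSet κ, (∃ m : HSet κ, m.1 ∈ F.1) →
      (∀ m : HSet κ, m.1 ∈ F.1 → ∀ z : HSet κ, z.1 ∈ m.1 → z.1 ∈ x.1) →
      ∃ m : HSet κ, m.1 ∈ F.1 ∧ ∀ m' : HSet κ, m'.1 ∈ F.1 →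
        (∀ z : HSet κ, z.1 ∈ m'.1 → z.1 ∈ m.1) → ∀ z : HSet κ, z.1 ∈ m.1 → z.1 ∈ m'.1 := by
  let ext : HSet κ → Set (HSet κ) := fun m => {y | y.1 ∈ m.1}
  constructor
  · intro hx F hF hFx
    have hfin : (ext '' {m | m.1 ∈ F.1}).Finite := by
      refine hx.finite_subsets.subset ?_
      rintro _ ⟨m, hm, rfl⟩
      exact fun z hz => hFx m hm z hz
    obtain ⟨_, ⟨m, hm, rfl⟩, hmin⟩ := hfin.exists_minimal (by
      obtain ⟨m, hm⟩ := hF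
      exact ⟨_, m, hm, rfl⟩)
    exact ⟨m, hm, fun m' hm' hle => hmin ⟨m', hm', rfl⟩ hle⟩
  · intro h
    by_contra hx
    have hinf : {y : HSet κ | y.1 ∈ x.1}.Infinite := hx
    have hω : Cardinal.aleph0 < κ := by
      refine aleph0_lt_of_infinite x.2 ((hinf.image Subtype.val_injective.injOn).mono ?_)
      rintro _ ⟨y, hy, rfl⟩
      exact hy
    let g := hinf.natEmbedding
    let f : ℕ → HSet κ := fun n =>
      ⟨x.1.sep fun z => ∀ k < n, z ≠ (g k).1.1,
        mem_of_subset x.2 fun z hz => (ZFSet.mem_sep.1 hz).1⟩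
    have mem_f : ∀ n z, z ∈ (f n).1 ↔ z ∈ x.1 ∧ ∀ k < n, z ≠ (g k).1.1 := fun n z =>
      ZFSet.mem_sep (p := fun z => ∀ k < n, z ≠ (g k).1.1)
    obtain ⟨F, hF⟩ := exists_mem_iff_of_countable hκ hω (Set.countable_range f)
    obtain ⟨m, hm, hmin⟩ := h F ⟨f 0, (hF _).2 ⟨0, rfl⟩⟩ (by
      intro m hm z hz
      obtain ⟨n, rfl⟩ := (hF m).1 hm
      exact ((mem_f n z).1 hz).1)
    obtain ⟨n, rfl⟩ := (hF m).1 hm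
    have hmem : (g n).1.1 ∈ (f n).1 := (mem_f n _).2 ⟨(g n).2, fun k hk hkn =>
      hk.ne' (g.injective (Subtype.ext (Subtype.ext hkn)))⟩
    have hle := hmin (f (n + 1)) ((hF _).2 ⟨n + 1, rfl⟩) (fun z hz => (mem_f n z).2
      ⟨((mem_f _ z).1 hz).1, fun k hk => ((mem_f _ z).1 hz).2 k (hk.trans n.lt_succ_self)⟩)
      (g n).1 hmem
    exact ((mem_f _ _).1 hle).2 n n.lt_succ_self rfl

end HSet

/-! ### Definability over an elementary submodel -/

open FirstOrder Language

section Definability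

variable {κ : Cardinal.{u}} {S : setLang.ElementarySubstructure (HSet κ)}

/-- `P` is first-order definable over `H(κ)` with parameters from `S`. The parameters are treated
as additional free variables, one for each element of `S`. -/
def IsDefinable (S : setLang.ElementarySubstructure (HSet κ)) {α : Type*}
    (P : (α → HSet κ) → Prop) : Prop :=
  ∃ φ : setLang.Formula (α ⊕ S), ∀ v, φ.Realize (Sum.elim v (fun s : S => (s : HSet κ))) ↔ P v

/-- `t` is a variable or a parameter from `S`. -/
class IsDefTerm (S : setLang.ElementarySubstructure (HSet κ)) {α : Type*}
    (t : (α → HSet κ) → HSet κ) : Prop where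
  exists_eq : ∃ x : α ⊕ S, ∀ v, t v = Sum.elim v (fun s : S => (s : HSet κ)) x

instance IsDefTerm.var {α : Type*} (i : α) : IsDefTerm S (fun v : α → HSet κ => v i) :=
  ⟨Sum.inl i, fun _ => rfl⟩

instance IsDefTerm.const {α : Type*} (c : S) : IsDefTerm S (fun _ : α → HSet κ => (c : HSet κ)) :=
  ⟨Sum.inr c, fun _ => rfl⟩

instance IsDefTerm.comp {α β : Type*} (t : (α → HSet κ) → HSet κ) (f : α → β)
    [h : IsDefTerm S t] : IsDefTerm S (fun w : β → HSet κ => t fun a => w (f a)) := by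
  obtain ⟨x | x, hx⟩ := h.exists_eq
  · exact ⟨Sum.inl (f x), fun v => hx _⟩
  · exact ⟨Sum.inr x, fun v => hx _⟩

namespace IsDefinable

variable {α : Type*} {P Q : (α → HSet κ) → Prop}

theorem congr (hP : IsDefinable S P) (h : ∀ v, P v ↔ Q v) : IsDefinable S Q := by
  obtain ⟨φ, hφ⟩ := hP
  exact ⟨φ, fun v => (hφ v).trans (h v)⟩

theorem mem (t t' : (α → HSet κ) → HSet κ) [ht : IsDefTerm S t] [ht' : IsDefTerm S t'] :
    IsDefinable S fun v => (t v).1 ∈ (t' v).1 := by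
  obtain ⟨x, hx⟩ := ht.exists_eq
  obtain ⟨x', hx'⟩ := ht'.exists_eq
  refine ⟨Relations.formula₂ (L := setLang) MemRel.mem (Term.var x) (Term.var x'), fun v => ?_⟩
  beta_reduce
  rw [hx, hx']
  exact Formula.realize_rel₂

theorem eq (t t' : (α → HSet κ) → HSet κ) [ht : IsDefTerm S t] [ht' : IsDefTerm S t'] :
    IsDefinable S fun v => t v = t' v := by
  obtain ⟨x, hx⟩ := ht.exists_eq
  obtain ⟨x', hx'⟩ := ht'.exists_eq
  refine ⟨(Term.var x).equal (Term.var x'), fun v => ?_⟩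
  beta_reduce
  rw [hx, hx']
  exact Formula.realize_equal

theorem not (hP : IsDefinable S P) : IsDefinable S fun v => ¬ P v := by
  obtain ⟨φ, hφ⟩ := hP
  exact ⟨φ.not, fun v => by rw [Formula.realize_not, hφ]⟩

theorem imp (hP : IsDefinable S P) (hQ : IsDefinable S Q) : IsDefinable S fun v => P v → Q v := by
  obtain ⟨φ, hφ⟩ := hP
  obtain ⟨ψ, hψ⟩ := hQ
  exact ⟨φ.imp ψ, fun v => by rw [Formula.realize_imp, hφ, hψ]⟩

theorem and (hP : IsDefinable S P) (hQ : IsDefinable S Q) : IsDefinable S fun v => P v ∧ Q v :=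
  (hP.imp hQ.not).not.congr fun v => by tauto

theorem or (hP : IsDefinable S P) (hQ : IsDefinable S Q) : IsDefinable S fun v => P v ∨ Q v :=
  (hP.not.imp hQ).congr fun v => by tauto

theorem iff (hP : IsDefinable S P) (hQ : IsDefinable S Q) : IsDefinable S fun v => (P v ↔ Q v) :=
  ((hP.imp hQ).and (hQ.imp hP)).congr fun v => by tauto

theorem true : IsDefinable S fun _ : α → HSet κ => True :=
  ⟨⊤, fun _ => by simp⟩

theorem ex {R : (α → HSet κ) → HSet κ → Prop}
    (hR : IsDefinable S fun w : α ⊕ Unit → HSet κ => R (fun a => w (Sum.inl a)) (w (Sum.inr ()))) :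
    IsDefinable S fun v => ∃ x, R v x := by
  obtain ⟨φ, hφ⟩ := hR
  let σ : (α ⊕ Unit) ⊕ S → (α ⊕ S) ⊕ Unit :=
    Sum.elim (Sum.map Sum.inl id) (Sum.inl ∘ Sum.inr)
  refine ⟨(φ.relabel σ).iExs Unit, fun v => ?_⟩
  rw [Formula.realize_iExs]
  have key : ∀ i : Unit → HSet κ,
      (φ.relabel σ).Realize (Sum.elim (Sum.elim v fun s : S => (s : HSet κ)) i) ↔ R v (i ()) := by
    intro i
    rw [Formula.realize_relabel]
    refine Iff.trans (iff_of_eq (congrArg _ (funext ?_))) (hφ (Sum.elim v i))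
    rintro ((a | a) | s) <;> rfl
  exact ⟨fun ⟨i, hi⟩ => ⟨i (), (key i).1 hi⟩, fun ⟨x, hx⟩ => ⟨fun _ => x, (key _).2 hx⟩⟩

theorem all {R : (α → HSet κ) → HSet κ → Prop}
    (hR : IsDefinable S fun w : α ⊕ Unit → HSet κ => R (fun a => w (Sum.inl a)) (w (Sum.inr ()))) :
    IsDefinable S fun v => ∀ x, R v x :=
  (ex (R := fun v x => ¬ R v x) hR.not).not.congr fun v => by simp

theorem forall_finset {ι : Type*} {R : ι → (α → HSet κ) → Prop} (s : Finset ι)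
    (hR : ∀ i ∈ s, IsDefinable S (R i)) : IsDefinable S fun v => ∀ i ∈ s, R i v := by
  classical
  induction s using Finset.induction_on with
  | empty => exact true.congr fun v => by simp
  | insert a s _ ih =>
    refine ((hR a (s.mem_insert_self a)).and
      (ih fun i hi => hR i (Finset.mem_insert_of_mem hi))).congr fun v => ?_
    rw [Finset.forall_mem_insert]

theorem exists_finset {ι : Type*} {R : ι → (α → HSet κ) → Prop} (s : Finset ι)
    (hR : ∀ i ∈ s, IsDefinable S (R i)) : IsDefinable S fun v => ∃ i ∈ s, R i v :=
  (forall_finset s fun i hi => (hR i hi).not).not.congr fun v => by simp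

theorem eq_singleton (hκ : κ.IsRegular) (t t' : (α → HSet κ) → HSet κ) [IsDefTerm S t]
    [IsDefTerm S t'] : IsDefinable S fun v => (t v).1 = {(t' v).1} := by
  refine (all (R := fun v z => z.1 ∈ (t v).1 ↔ z = t' v) (.iff (.mem _ _) (.eq _ _))).congr
    fun v => ?_
  rw [HSet.eq_iff_forall fun z hz => HSet.mem_of_mem (HSet.singleton_mem hκ (t' v).2) hz]
  simp [Subtype.ext_iff]

theorem eq_upair (hκ : κ.IsRegular) (t t' t'' : (α → HSet κ) → HSet κ) [IsDefTerm S t]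
    [IsDefTerm S t'] [IsDefTerm S t''] :
    IsDefinable S fun v => (t v).1 = {(t' v).1, (t'' v).1} := by
  refine (all (R := fun v z => z.1 ∈ (t v).1 ↔ z = t' v ∨ z = t'' v)
    (.iff (.mem _ _) (.or (.eq _ _) (.eq _ _)))).congr fun v => ?_
  rw [HSet.eq_iff_forall fun z hz => HSet.mem_of_mem (HSet.upair_mem hκ (t' v).2 (t'' v).2) hz]
  simp [Subtype.ext_iff]

theorem eq_pair (hκ : κ.IsRegular) (t t' t'' : (α → HSet κ) → HSet κ) [IsDefTerm S t]
    [IsDefTerm S t'] [IsDefTerm S t''] :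
    IsDefinable S fun v => t v = HSet.pair hκ (t' v) (t'' v) := by
  refine (all (R := fun v z => z.1 ∈ (t v).1 ↔ z.1 = {(t' v).1} ∨ z.1 = {(t' v).1, (t'' v).1})
    (.iff (.mem _ _) (.or (eq_singleton hκ _ _) (eq_upair hκ _ _ _)))).congr fun v => ?_
  rw [Subtype.ext_iff, HSet.eq_iff_forall fun z hz =>
    HSet.mem_of_mem (HSet.pair hκ (t' v) (t'' v)).2 hz]
  simp [HSet.pair, ZFSet.pair]

theorem pair_mem (hκ : κ.IsRegular) (t t' t'' : (α → HSet κ) → HSet κ) [IsDefTerm S t]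
    [IsDefTerm S t'] [IsDefTerm S t''] :
    IsDefinable S fun v => (HSet.pair hκ (t' v) (t'' v)).1 ∈ (t v).1 :=
  (ex (R := fun v p => p = HSet.pair hκ (t' v) (t'' v) ∧ p.1 ∈ (t v).1)
    (.and (eq_pair hκ _ _ _) (.mem _ _))).congr fun v => by simp

theorem hasFiniteExtent (hκ : κ.IsRegular) (t : (α → HSet κ) → HSet κ) [IsDefTerm S t] :
    IsDefinable S fun v => HSet.HasFiniteExtent (t v) := by
  refine IsDefinable.congr ?_ fun v => (HSet.hasFiniteExtent_iff hκ (t v)).symm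
  refine .all (.imp (.ex ?_) (.imp (.all (.imp ?_ (.all (.imp ?_ ?_))))
    (.ex (.and ?_ (.all (.imp ?_ (.imp (.all (.imp ?_ ?_)) (.all (.imp ?_ ?_)))))))))
  all_goals
    beta_reduce
    exact .mem _ _

/-- A solvable condition on finitely many unknowns has a solution in the submodel. -/
theorem exists_forall_mem {β : Type*} [Finite β] {P : (β → HSet κ) → Prop}
    (hP : IsDefinable S P) (h : ∃ w, P w) : ∃ w : β → S, P fun b => (w b : HSet κ) := by
  obtain ⟨φ, hφ⟩ := hP
  obtain ⟨w, hw⟩ := h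
  have hex : ((φ.relabel Sum.swap).iExs β).Realize (S.subtype ∘ (id : S → S)) := by
    rw [Formula.realize_iExs]
    refine ⟨w, ?_⟩
    rw [Formula.realize_relabel]
    refine Eq.mp (congrArg _ (funext ?_)) ((hφ w).2 hw)
    rintro (a | a) <;> rfl
  rw [S.subtype.map_formula, Formula.realize_iExs] at hex
  obtain ⟨i, hi⟩ := hex
  rw [Formula.realize_relabel, ← S.subtype.map_formula] at hi
  refine ⟨i, (hφ _).1 (Eq.mp (congrArg _ (funext ?_)) hi)⟩
  rintro (a | a) <;> rfl

theorem exists_mem {P : HSet κ → Prop} (hP : IsDefinable S fun v : Unit → HSet κ => P (v ()))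
    (h : ∃ x, P x) : ∃ x : S, P x := by
  obtain ⟨x, hx⟩ := h
  obtain ⟨w, hw⟩ := hP.exists_forall_mem ⟨fun _ => x, hx⟩
  exact ⟨w (), hw⟩

/-- A definable collection with only finitely many members in the submodel lies entirely in it. -/
theorem mem_of_finite {P : HSet κ → Prop} (hP : IsDefinable S fun v : Unit → HSet κ => P (v ()))
    (hfin : {x : S | P x}.Finite) {x : HSet κ} (hx : P x) : x ∈ S := by
  by_contra hxS
  obtain ⟨y, hy, hyne⟩ := exists_mem (P := fun x => P x ∧ ∀ s ∈ hfin.toFinset, ¬ x = (s : HSet κ))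
    (.and hP (.forall_finset _ fun s _ => .not (.eq _ _)))
    ⟨x, hx, fun s _ h => hxS (h ▸ s.2)⟩
  exact hyne y (hfin.mem_toFinset.2 hy) rfl

end IsDefinable

end Definability

/-! ### Definable lattices and their traces on an elementary submodel -/

section Trace

variable {κ : Cardinal.{u}} {S : setLang.ElementarySubstructure (HSet κ)}
  {Λ : Type*}

/-- The order of `Λ`, carried to `H(κ)` along `ι`. -/
def LeAlong [LE Λ] (ι : Λ → HSet κ) (x y : HSet κ) : Prop := ∃ a b, a ≤ b ∧ ι a = x ∧ ι b = y

/-- `ι` embeds `Λ` in `H(κ)` so that the image and its order are definable over `H(κ)` with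
parameters from `S`. -/
structure IsDefinableOrder (S : setLang.ElementarySubstructure (HSet κ)) [PartialOrder Λ]
    (ι : Λ → HSet κ) : Prop where
  injective : Function.Injective ι
  isDefinable : ∀ {α : Type} (t t' : (α → HSet κ) → HSet κ) [IsDefTerm S t] [IsDefTerm S t'],
    IsDefinable S fun v => LeAlong ι (t v) (t' v)

/-- `x` is the image of the least element. -/
def BotAlong [LE Λ] (ι : Λ → HSet κ) (x : HSet κ) : Prop :=
  ∀ y, LeAlong ι y y → LeAlong ι x y

/-- `x` is the image of the greatest element. -/
def TopAlong [LE Λ] (ι : Λ → HSet κ) (x : HSet κ) : Prop :=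
  ∀ y, LeAlong ι y y → LeAlong ι y x

namespace IsDefinableOrder

section PartialOrder

variable [PartialOrder Λ] {ι : Λ → HSet κ}

theorem le_iff (H : IsDefinableOrder S ι) {a b : Λ} : LeAlong ι (ι a) (ι b) ↔ a ≤ b := by
  refine ⟨?_, fun h => ⟨a, b, h, rfl, rfl⟩⟩
  rintro ⟨a', b', h, ha, hb⟩
  rwa [← H.injective ha, ← H.injective hb]

theorem le_self_iff (H : IsDefinableOrder S ι) {x : HSet κ} : LeAlong ι x x ↔ ∃ a, ι a = x := by
  refine ⟨fun ⟨a, _, _, ha, _⟩ => ⟨a, ha⟩, ?_⟩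
  rintro ⟨a, rfl⟩
  exact H.le_iff.2 le_rfl

theorem botAlong_iff (H : IsDefinableOrder S ι) {a : Λ} : BotAlong ι (ι a) ↔ IsBot a := by
  refine ⟨fun h b => H.le_iff.1 (h _ (H.le_iff.2 le_rfl)), fun h y hy => ?_⟩
  obtain ⟨b, rfl⟩ := H.le_self_iff.1 hy
  exact H.le_iff.2 (h b)

theorem topAlong_iff (H : IsDefinableOrder S ι) {a : Λ} : TopAlong ι (ι a) ↔ IsTop a := by
  refine ⟨fun h b => H.le_iff.1 (h _ (H.le_iff.2 le_rfl)), fun h y hy => ?_⟩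
  obtain ⟨b, rfl⟩ := H.le_self_iff.1 hy
  exact H.le_iff.2 (h b)

theorem isDefinable_bot (H : IsDefinableOrder S ι) {α : Type} (t : (α → HSet κ) → HSet κ)
    [IsDefTerm S t] : IsDefinable S fun v => BotAlong ι (t v) :=
  .all (.imp (H.isDefinable _ _) (H.isDefinable _ _))

theorem isDefinable_top (H : IsDefinableOrder S ι) {α : Type} (t : (α → HSet κ) → HSet κ)
    [IsDefTerm S t] : IsDefinable S fun v => TopAlong ι (t v) :=
  .all (.imp (H.isDefinable _ _) (H.isDefinable _ _))

instance isDefTerm_apply {α : Type*} (a : {a : Λ // ι a ∈ S}) :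
    IsDefTerm S fun _ : α → HSet κ => ι a.1 :=
  IsDefTerm.const (⟨ι a.1, a.2⟩ : S)

/-- A finite lattice is contained in every elementary submodel over which it is definable. -/
theorem apply_mem_of_finite (H : IsDefinableOrder S ι) [Finite Λ] (a : Λ) : ι a ∈ S := by
  refine IsDefinable.mem_of_finite (P := fun x => LeAlong ι x x) (H.isDefinable _ _) ?_
    (H.le_iff.2 le_rfl)
  refine Set.Finite.of_finite_image (f := Subtype.val) ((Set.finite_range ι).subset ?_)
    Subtype.val_injective.injOn
  rintro _ ⟨x, hx, rfl⟩
  exact H.le_self_iff.1 hx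

/-- A definable condition satisfied in `Λ` is satisfied in the trace of `Λ`. -/
theorem exists_reflect (H : IsDefinableOrder S ι) {P : HSet κ → Prop}
    (hP : IsDefinable S fun v : Unit → HSet κ => P (v ())) (h : ∃ a, P (ι a)) :
    ∃ a : {a : Λ // ι a ∈ S}, P (ι a.1) := by
  obtain ⟨a, ha⟩ := h
  obtain ⟨x, hx, hPx⟩ := IsDefinable.exists_mem (P := fun x => LeAlong ι x x ∧ P x)
    (.and (H.isDefinable _ _) hP) ⟨ι a, H.le_iff.2 le_rfl, ha⟩
  obtain ⟨b, hb⟩ := H.le_self_iff.1 hx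
  rw [← hb] at hPx
  exact ⟨⟨b, by rw [hb]; exact x.2⟩, hPx⟩

end PartialOrder

section Lattice

variable [Lattice Λ] {ι : Λ → HSet κ}

theorem sup_mem (H : IsDefinableOrder S ι) (a b : {a : Λ // ι a ∈ S}) : ι (a.1 ⊔ b.1) ∈ S := by
  obtain ⟨c, ⟨hac, hbc⟩, hc⟩ := H.exists_reflect (P := fun x =>
    (LeAlong ι (ι a.1) x ∧ LeAlong ι (ι b.1) x) ∧
      ∀ y, LeAlong ι (ι a.1) y → LeAlong ι (ι b.1) y → LeAlong ι x y)
    (.and (.and (H.isDefinable _ _) (H.isDefinable _ _))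
      (.all (.imp (H.isDefinable _ _) (.imp (H.isDefinable _ _) (H.isDefinable _ _)))))
    ⟨a.1 ⊔ b.1, ⟨H.le_iff.2 le_sup_left, H.le_iff.2 le_sup_right⟩, by
      rintro _ ⟨_, c, hac, ha, rfl⟩ hbc
      rw [H.injective ha] at hac
      exact H.le_iff.2 (sup_le hac (H.le_iff.1 hbc))⟩
  have hle := H.le_iff.1 (hc (ι (a.1 ⊔ b.1)) (H.le_iff.2 le_sup_left) (H.le_iff.2 le_sup_right))
  rw [← hle.antisymm (sup_le (H.le_iff.1 hac) (H.le_iff.1 hbc))]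
  exact c.2

theorem inf_mem (H : IsDefinableOrder S ι) (a b : {a : Λ // ι a ∈ S}) : ι (a.1 ⊓ b.1) ∈ S := by
  obtain ⟨c, ⟨hac, hbc⟩, hc⟩ := H.exists_reflect (P := fun x =>
    (LeAlong ι x (ι a.1) ∧ LeAlong ι x (ι b.1)) ∧
      ∀ y, LeAlong ι y (ι a.1) → LeAlong ι y (ι b.1) → LeAlong ι y x)
    (.and (.and (H.isDefinable _ _) (H.isDefinable _ _))
      (.all (.imp (H.isDefinable _ _) (.imp (H.isDefinable _ _) (H.isDefinable _ _)))))
    ⟨a.1 ⊓ b.1, ⟨H.le_iff.2 inf_le_left, H.le_iff.2 inf_le_right⟩, by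
      rintro _ ⟨c, _, hac, rfl, ha⟩ hbc
      rw [H.injective ha] at hac
      exact H.le_iff.2 (le_inf hac (H.le_iff.1 hbc))⟩
  have hle := H.le_iff.1 (hc (ι (a.1 ⊓ b.1)) (H.le_iff.2 inf_le_left) (H.le_iff.2 inf_le_right))
  rw [hle.antisymm (le_inf (H.le_iff.1 hac) (H.le_iff.1 hbc))]
  exact c.2

end Lattice

variable [DistribLattice Λ] [BoundedOrder Λ] {ι : Λ → HSet κ}

theorem bot_mem (H : IsDefinableOrder S ι) : ι ⊥ ∈ S := by
  obtain ⟨c, hc⟩ := H.exists_reflect (H.isDefinable_bot _) ⟨⊥, H.botAlong_iff.2 isBot_bot⟩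
  rw [← (H.botAlong_iff.1 hc).eq_bot]
  exact c.2

theorem top_mem (H : IsDefinableOrder S ι) : ι ⊤ ∈ S := by
  obtain ⟨c, hc⟩ := H.exists_reflect (H.isDefinable_top _) ⟨⊤, H.topAlong_iff.2 isTop_top⟩
  rw [← (H.topAlong_iff.1 hc).eq_top]
  exact c.2

/-- The trace of a definable lattice is a sublattice. -/
abbrev distribLatticeTrace (H : IsDefinableOrder S ι) : DistribLattice {a : Λ // ι a ∈ S} :=
  { Subtype.lattice (P := fun a => ι a ∈ S) (fun a b ha hb => H.sup_mem ⟨a, ha⟩ ⟨b, hb⟩)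
      (fun a b ha hb => H.inf_mem ⟨a, ha⟩ ⟨b, hb⟩) with
    le_sup_inf := fun a b c =>
      (le_sup_inf : (a.1 ⊔ b.1) ⊓ (a.1 ⊔ c.1) ≤ a.1 ⊔ b.1 ⊓ c.1) }

/-- The bounds of a definable lattice belong to its trace. -/
abbrev boundedOrderTrace (H : IsDefinableOrder S ι) : BoundedOrder {a : Λ // ι a ∈ S} where
  top := ⟨⊤, H.top_mem⟩
  bot := ⟨⊥, H.bot_mem⟩
  le_top a := (le_top : a.1 ≤ ⊤)
  bot_le a := (bot_le : ⊥ ≤ a.1)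

theorem isBot_coe_iff (H : IsDefinableOrder S ι) {a : {a : Λ // ι a ∈ S}} :
    IsBot a.1 ↔ IsBot a :=
  ⟨fun h b => h b.1, fun h _ => (show a.1 ≤ ⊥ from h ⟨⊥, H.bot_mem⟩).trans bot_le⟩

theorem isTop_coe_iff (H : IsDefinableOrder S ι) {a : {a : Λ // ι a ∈ S}} :
    IsTop a.1 ↔ IsTop a :=
  ⟨fun h b => h b.1, fun h _ => le_top.trans (show ⊤ ≤ a.1 from h ⟨⊤, H.top_mem⟩)⟩

/-- That a given pair of elements of the trace has a separating element is definable. -/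
theorem isSeparative_trace (H : IsDefinableOrder S ι) (hΛ : IsSeparative Λ) :
    @IsSeparative {a : Λ // ι a ∈ S} H.distribLatticeTrace.toLattice H.boundedOrderTrace := by
  intro a b hab
  obtain ⟨c, hca, hc, hcb⟩ := hΛ a.1 b.1 hab
  obtain ⟨d, hda, hd, hdb⟩ := H.exists_reflect (P := fun x =>
    LeAlong ι x (ι a.1) ∧ ¬ BotAlong ι x ∧
      ∀ y, LeAlong ι y x → LeAlong ι y (ι b.1) → BotAlong ι y)
    (.and (H.isDefinable _ _) (.and (H.isDefinable_bot _).not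
      (.all (.imp (H.isDefinable _ _) (.imp (H.isDefinable _ _) (H.isDefinable_bot _))))))
    ⟨c, H.le_iff.2 hca, fun h => hc (H.botAlong_iff.1 h).eq_bot, by
      rintro _ ⟨y, _, hyc, rfl, hc'⟩ hyb
      rw [H.injective hc'] at hyc
      rw [H.botAlong_iff, isBot_iff_eq_bot, ← le_bot_iff, ← hcb]
      exact le_inf hyc (H.le_iff.1 hyb)⟩
  refine ⟨d, H.le_iff.1 hda, fun h => hd ?_, Subtype.ext ?_⟩
  · rw [H.botAlong_iff, h]
    exact isBot_bot
  · exact (H.botAlong_iff.1 (hdb (ι (d.1 ⊓ b.1)) (H.le_iff.2 inf_le_left)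
      (H.le_iff.2 inf_le_right))).eq_bot

/-- A finite family in the trace has only trivial lower bounds in `Λ` if it has only trivial lower
bounds in the trace, as its meet belongs to the trace. -/
theorem isBot_of_forall_le (H : IsDefinableOrder S ι) {J : Type*} (s : Finset J)
    (f : J → {a : Λ // ι a ∈ S})
    (hs : ∀ x : {a : Λ // ι a ∈ S}, (∀ j ∈ s, x ≤ f j) → IsBot x) {x : Λ}
    (hx : ∀ j ∈ s, x ≤ (f j).1) : IsBot x := by
  have hmem : ι (s.inf fun j => (f j).1) ∈ S :=
    Finset.inf_induction (p := fun a => ι a ∈ S) H.top_mem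
      (fun a ha b hb => H.inf_mem ⟨a, ha⟩ ⟨b, hb⟩) fun j _ => (f j).2
  have hbot := H.isBot_coe_iff.2 (hs ⟨_, hmem⟩ fun j hj => Finset.inf_le (f := fun j => (f j).1) hj)
  exact fun y => (Finset.le_inf hx).trans (hbot y)

/-- A sequence of covers in the trace need not belong to the submodel. The cover property of `Λ`
gives finitely many elements, which only involve finitely many of the covers, and elementarity
moves this finite tuple to the trace. -/
theorem coverProperty_trace (H : IsDefinableOrder S ι) (hΛ : CoverProperty Λ) :
    CoverProperty {a : Λ // ι a ∈ S} := by
  classical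
  intro A hA
  obtain ⟨B, h1, h2, h3⟩ := hΛ (fun i => (A i).image Subtype.val) (by
    intro i x hx
    exact H.isBot_of_forall_le (A i) id (hA i) fun a ha => hx a.1 (Finset.mem_image_of_mem _ ha))
  let e := B.equivFin
  let idx : Fin B.card → ℕ := fun j => (e.symm j).1.1
  obtain ⟨w, hw1, hw2, hw3⟩ := IsDefinable.exists_forall_mem (S := S)
    (P := fun w : Fin B.card → HSet κ =>
      (∀ j ∈ Finset.univ, ∃ a ∈ A (idx j), LeAlong ι (ι a.1) (w j)) ∧
      (∀ j ∈ Finset.univ, ∀ k ∈ Finset.univ.filter fun k => idx j = idx k,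
        w j = w k ∨ ∀ x, LeAlong ι (w j) x → LeAlong ι (w k) x → TopAlong ι x) ∧
      ∀ x, LeAlong ι x x → (∀ j ∈ Finset.univ, LeAlong ι x (w j)) → BotAlong ι x)
    (.and (.forall_finset _ fun j _ => .exists_finset _ fun a _ => H.isDefinable _ _)
      (.and (.forall_finset _ fun j _ => .forall_finset _ fun k _ => .or (.eq _ _)
          (.all (.imp (H.isDefinable _ _) (.imp (H.isDefinable _ _) (H.isDefinable_top _)))))
        (.all (.imp (H.isDefinable _ _) (.imp (.forall_finset _ fun j _ => H.isDefinable _ _)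
          (H.isDefinable_bot _))))))
    ⟨fun j => ι (e.symm j).1.2, by
      refine ⟨fun j _ => ?_, fun j _ k hk => ?_, ?_⟩
      · obtain ⟨_, hA', hle⟩ := h1 _ (e.symm j).2
        obtain ⟨a, ha, rfl⟩ := Finset.mem_image.1 hA'
        exact ⟨a, ha, H.le_iff.2 hle⟩
      · refine (h2 _ (e.symm j).2 _ (e.symm k).2 (Finset.mem_filter.1 hk).2).imp
          (congrArg ι) fun h => ?_
        rintro _ ⟨_, x, hjx, hj, rfl⟩ hkx
        rw [H.injective hj] at hjx
        exact H.topAlong_iff.2 (h x hjx (H.le_iff.1 hkx))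
      · intro x hx hle
        obtain ⟨x, rfl⟩ := H.le_self_iff.1 hx
        refine H.botAlong_iff.2 (h3 x fun p hp => H.le_iff.1 ?_)
        simpa using hle (e ⟨p, hp⟩) (Finset.mem_univ _)⟩
  have hb : ∀ j, ∃ b : {a : Λ // ι a ∈ S}, ι b.1 = w j := by
    intro j
    obtain ⟨a, -, -, b, -, -, hb⟩ := hw1 j (Finset.mem_univ j)
    exact ⟨⟨b, hb ▸ (w j).2⟩, hb⟩
  choose b hb using hb
  simp only [← hb] at hw1 hw2 hw3
  refine ⟨Finset.univ.image fun j => (idx j, b j), ?_, ?_, ?_⟩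
  · simp only [Finset.forall_mem_image]
    intro j hj
    obtain ⟨a, ha, hle⟩ := hw1 j hj
    exact ⟨a, ha, H.le_iff.1 hle⟩
  · simp only [Finset.forall_mem_image]
    intro j hj k hk hjk
    refine (hw2 j hj k (Finset.mem_filter.2 ⟨hk, hjk⟩)).imp
      (fun h => Subtype.ext (H.injective h)) fun h x hjx hkx => ?_
    exact H.isTop_coe_iff.1 (H.topAlong_iff.1 (h _ (H.le_iff.2 hjx) (H.le_iff.2 hkx)))
  · simp only [Finset.forall_mem_image]
    intro x hx
    exact H.isBot_coe_iff.1 (H.botAlong_iff.1 (hw3 _ (H.le_iff.2 le_rfl)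
      fun j hj => H.le_iff.2 (hx hj)))

end IsDefinableOrder

end Trace

/-! ### Sequences of covers in `H(κ)` -/

section Sequences

variable {κ : Cardinal.{u}} {S : setLang.ElementarySubstructure (HSet κ)} {Λ : Type*}

/-- `C ⊆ I × Λ` codes a family of covers indexed by `I`: every section `{a | (i, a) ∈ C}` contains
a finite set without nontrivial lower bounds. -/
def CodesCovers [LE Λ] (hκ : κ.IsRegular) (ι : Λ → HSet κ) (I C : HSet κ) : Prop :=
  ∀ i : HSet κ, i.1 ∈ I.1 → ∃ A : HSet κ, HSet.HasFiniteExtent A ∧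
    (∀ a : HSet κ, a.1 ∈ A.1 → LeAlong ι a a ∧ (HSet.pair hκ i a).1 ∈ C.1) ∧
    ∀ x, LeAlong ι x x → (∀ a : HSet κ, a.1 ∈ A.1 → LeAlong ι x a) → BotAlong ι x

/-- The section of `B` at `i` codes a disjoint family that refines the section of `C` at `i`, and
all these families together code a cover. -/
def CodesRefinement [LE Λ] (hκ : κ.IsRegular) (ι : Λ → HSet κ) (C B : HSet κ) : Prop :=
  (∀ i b, (HSet.pair hκ i b).1 ∈ B.1 → ∃ a, (HSet.pair hκ i a).1 ∈ C.1 ∧ LeAlong ι a b) ∧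
  (∀ i b b', (HSet.pair hκ i b).1 ∈ B.1 → (HSet.pair hκ i b').1 ∈ B.1 →
    b = b' ∨ ∀ x, LeAlong ι b x → LeAlong ι b' x → TopAlong ι x) ∧
  ∀ x, LeAlong ι x x → (∀ i b, (HSet.pair hκ i b).1 ∈ B.1 → LeAlong ι x b) → BotAlong ι x

theorem HSet.pair_inj (hκ : κ.IsRegular) {x y x' y' : HSet κ} :
    HSet.pair hκ x y = HSet.pair hκ x' y' ↔ x = x' ∧ y = y' := by
  simp [HSet.pair, Subtype.ext_iff]

namespace IsDefinableOrder

section PartialOrder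

variable [PartialOrder Λ] {ι : Λ → HSet κ}

theorem isDefinable_codesCovers (H : IsDefinableOrder S ι) (hκ : κ.IsRegular) {α : Type}
    (t t' : (α → HSet κ) → HSet κ) [IsDefTerm S t] [IsDefTerm S t'] :
    IsDefinable S fun v => CodesCovers hκ ι (t v) (t' v) := by
  refine .all (.imp (.mem _ _) (.ex (.and (.hasFiniteExtent hκ _) (.and
    (.all (.imp ?_ (.and ?_ ?_))) (.all (.imp ?_ (.imp (.all (.imp ?_ ?_)) ?_)))))))
  all_goals beta_reduce
  all_goals first
    | exact .mem _ _
    | exact .pair_mem hκ _ _ _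
    | exact H.isDefinable _ _
    | exact H.isDefinable_bot _

theorem isDefinable_codesRefinement (H : IsDefinableOrder S ι) (hκ : κ.IsRegular) {α : Type}
    (t t' : (α → HSet κ) → HSet κ) [IsDefTerm S t] [IsDefTerm S t'] :
    IsDefinable S fun v => CodesRefinement hκ ι (t v) (t' v) := by
  refine .and (.all (.all (.imp ?_ (.ex (.and ?_ ?_))))) (.and
    (.all (.all (.all (.imp ?_ (.imp ?_ (.or ?_ (.all (.imp ?_ (.imp ?_ ?_)))))))))
    (.all (.imp ?_ (.imp (.all (.all (.imp ?_ ?_))) ?_))))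
  all_goals beta_reduce
  all_goals first
    | exact .eq _ _
    | exact .pair_mem hκ _ _ _
    | exact H.isDefinable _ _
    | exact H.isDefinable_bot _
    | exact H.isDefinable_top _

/-- A sequence of covers without disjoint refinements is coded by a set in `H(κ)`. The `n`-th index
is represented by the `n`-th term of an injective sequence in `Λ`. -/
theorem exists_codesCovers_of_not_coverProperty (H : IsDefinableOrder S ι) (hκ : κ.IsRegular)
    (hω : Cardinal.aleph0 < κ) [Infinite Λ] (hΛ : ¬ CoverProperty Λ) :
    ∃ I C : HSet κ, ¬ HSet.HasFiniteExtent I ∧ CodesCovers hκ ι I C ∧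
      ∀ B, HSet.HasFiniteExtent B → ¬ CodesRefinement hκ ι C B := by
  classical
  unfold CoverProperty at hΛ
  push Not at hΛ
  obtain ⟨A, hA, hbad⟩ := hΛ
  let label : ℕ → HSet κ := fun n => ι (Infinite.natEmbedding Λ n)
  have hlabel : Function.Injective label := H.injective.comp (Infinite.natEmbedding Λ).injective
  obtain ⟨I, hI⟩ := HSet.exists_mem_iff_of_countable hκ hω (Set.countable_range label)
  obtain ⟨C, hC'⟩ := HSet.exists_mem_iff_of_countable hκ hω
    (Set.countable_iUnion fun n =>
      ((A n).finite_toSet.image fun a => HSet.pair hκ (label n) (ι a)).countable)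
  have hC : ∀ i a, (HSet.pair hκ i a).1 ∈ C.1 ↔ ∃ n, ∃ b ∈ A n, i = label n ∧ a = ι b := by
    intro i a
    rw [hC', Set.mem_iUnion]
    refine exists_congr fun n => exists_congr fun b => and_congr_right fun _ => ?_
    rw [HSet.pair_inj, eq_comm, eq_comm (a := ι b)]
  refine ⟨I, C, ?_, ?_, ?_⟩
  · intro hfin
    refine Set.infinite_range_of_injective hlabel (hfin.subset fun x hx => (hI x).2 hx)
  · intro i hi
    obtain ⟨n, rfl⟩ := (hI i).1 hi
    obtain ⟨A', hA'⟩ := HSet.exists_mem_iff_of_finite hκ ((A n).finite_toSet.image ι)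
    refine ⟨A', ((A n).finite_toSet.image ι).subset fun x hx => (hA' x).1 hx, ?_, ?_⟩
    · intro a ha
      obtain ⟨b, hb, rfl⟩ := (hA' a).1 ha
      exact ⟨H.le_iff.2 le_rfl, (hC _ _).2 ⟨n, b, hb, rfl, rfl⟩⟩
    · intro x hx hle
      obtain ⟨x, rfl⟩ := H.le_self_iff.1 hx
      refine H.botAlong_iff.2 (hA n x fun a ha => H.le_iff.1 (hle _ ?_))
      exact (hA' _).2 ⟨a, ha, rfl⟩
  · rintro B hB ⟨h1, h2, h3⟩
    have hfin : {p : ℕ × Λ | (HSet.pair hκ (label p.1) (ι p.2)).1 ∈ B.1}.Finite := by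
      refine Set.Finite.preimage (f := fun p : ℕ × Λ => HSet.pair hκ (label p.1) (ι p.2)) ?_ hB
      intro p _ q _ hpq
      obtain ⟨hp1, hp2⟩ := (HSet.pair_inj hκ).1 hpq
      exact Prod.ext (hlabel hp1) (H.injective hp2)
    have hmem : ∀ p : ℕ × Λ,
        p ∈ hfin.toFinset ↔ (HSet.pair hκ (label p.1) (ι p.2)).1 ∈ B.1 := fun p =>
      hfin.mem_toFinset
    obtain ⟨x, hx, hxbot⟩ := hbad hfin.toFinset (by
        intro p hp
        obtain ⟨a, ha, hle⟩ := h1 _ _ ((hmem p).1 hp)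
        obtain ⟨n, b, hb, hn, rfl⟩ := (hC _ _).1 ha
        exact ⟨b, hlabel hn ▸ hb, H.le_iff.1 hle⟩) (by
        intro p hp q hq hpq
        refine (h2 (label p.1) _ _ ((hmem p).1 hp) (hpq ▸ (hmem q).1 hq)).imp
          (fun h => H.injective h) fun h x hpx hqx => ?_
        exact H.topAlong_iff.1 (h _ (H.le_iff.2 hpx) (H.le_iff.2 hqx)))
    refine hxbot (H.botAlong_iff.1 (h3 _ (H.le_iff.2 le_rfl) fun i b hib => ?_))
    obtain ⟨a, ha, -, b', -, -, rfl⟩ := h1 i b hib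
    obtain ⟨n, -, -, rfl, -⟩ := (hC _ _).1 ha
    exact H.le_iff.2 (hx (n, b') ((hmem _).2 hib))

end PartialOrder

variable [DistribLattice Λ] [BoundedOrder Λ] {ι : Λ → HSet κ}

/-- A coded family of covers that belongs to the submodel yields a sequence of covers in the trace;
disjoint refinements of these covers in the trace form a finite set, so they belong to `H(κ)`. -/
theorem exists_codesRefinement (H : IsDefinableOrder S ι) (hκ : κ.IsRegular)
    (hT : CoverProperty {a : Λ // ι a ∈ S}) (I C : S) (hI : ¬ HSet.HasFiniteExtent I.1)
    (hC : CodesCovers hκ ι I.1 C.1) :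
    ∃ B, HSet.HasFiniteExtent B ∧ CodesRefinement hκ ι C.1 B := by
  classical
  have hinf : {i : S | i.1.1 ∈ I.1.1}.Infinite := by
    intro hfin
    refine hI ((hfin.image Subtype.val).subset fun i hi => ?_)
    exact ⟨⟨i, IsDefinable.mem_of_finite (P := fun i => i.1 ∈ I.1.1) (.mem _ _) hfin hi⟩, hi, rfl⟩
  let label : ℕ → S := fun n => (hinf.natEmbedding _ n).1
  have hlabel : Function.Injective label :=
    Subtype.val_injective.comp (hinf.natEmbedding _).injective
  have hcov : ∀ n, ∃ A : Finset {a : Λ // ι a ∈ S},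
      (∀ a ∈ A, (HSet.pair hκ (label n).1 (ι a.1)).1 ∈ C.1.1) ∧
      ∀ x, (∀ a ∈ A, x ≤ a) → IsBot x := by
    intro n
    obtain ⟨A, hAfin, hA, hAbot⟩ := IsDefinable.exists_mem (S := S)
      (P := fun A => HSet.HasFiniteExtent A ∧
        (∀ a : HSet κ, a.1 ∈ A.1 →
          LeAlong ι a a ∧ (HSet.pair hκ (label n).1 a).1 ∈ C.1.1) ∧
        ∀ x, LeAlong ι x x → (∀ a : HSet κ, a.1 ∈ A.1 → LeAlong ι x a) → BotAlong ι x)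
      (.and (.hasFiniteExtent hκ _) (.and
        (.all (.imp (.mem _ _) (.and (H.isDefinable _ _) (.pair_mem hκ _ _ _))))
        (.all (.imp (H.isDefinable _ _) (.imp (.all (.imp (.mem _ _) (H.isDefinable _ _)))
          (H.isDefinable_bot _))))))
      (hC _ (hinf.natEmbedding _ n).2)
    have hfin : {a : {a : Λ // ι a ∈ S} | (ι a.1).1 ∈ A.1.1}.Finite :=
      Set.Finite.preimage (f := fun a : {a : Λ // ι a ∈ S} => ι a.1)
        ((H.injective.comp Subtype.val_injective).injOn) hAfin
    refine ⟨hfin.toFinset, fun a ha => (hA _ (hfin.mem_toFinset.1 ha)).2, fun x hx => ?_⟩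
    refine H.isBot_coe_iff.1 (H.botAlong_iff.1 (hAbot _ (H.le_iff.2 le_rfl) fun a ha => ?_))
    obtain ⟨b, rfl⟩ := H.le_self_iff.1 (hA a ha).1
    have hb : ι b ∈ S := by
      refine IsDefinable.mem_of_finite (P := fun a => a.1 ∈ A.1.1) (.mem _ _) ?_ ha
      exact Set.Finite.preimage (f := (Subtype.val : S → HSet κ)) Subtype.val_injective.injOn hAfin
    exact H.le_iff.2 (hx ⟨b, hb⟩ (hfin.mem_toFinset.2 ha))
  choose A hAC hAbot using hcov
  obtain ⟨B, h1, h2, h3⟩ := hT A hAbot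
  have hBfin := B.finite_toSet.image fun p => HSet.pair hκ (label p.1).1 (ι p.2.1)
  obtain ⟨B', hB'⟩ := HSet.exists_mem_iff_of_finite hκ hBfin
  have hmem : ∀ i b, (HSet.pair hκ i b).1 ∈ B'.1 ↔
      ∃ p ∈ B, i = (label p.1).1 ∧ b = ι p.2.1 := by
    intro i b
    rw [hB']
    refine exists_congr fun p => and_congr_right fun _ => ?_
    rw [HSet.pair_inj, eq_comm, eq_comm (a := ι _)]
  refine ⟨B', hBfin.subset fun x hx => (hB' x).1 hx, ?_, ?_, ?_⟩
  · intro i b hib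
    obtain ⟨p, hp, rfl, rfl⟩ := (hmem i b).1 hib
    obtain ⟨a, ha, hle⟩ := h1 p hp
    exact ⟨_, hAC _ a ha, H.le_iff.2 hle⟩
  · intro i b b' hib hib'
    obtain ⟨p, hp, rfl, rfl⟩ := (hmem _ _).1 hib
    obtain ⟨q, hq, hpq, rfl⟩ := (hmem _ _).1 hib'
    refine (h2 p hp q hq (hlabel (Subtype.ext hpq))).imp (fun h => by rw [h]) fun h => ?_
    -- the join of two elements of the trace belongs to the trace
    have htop := H.isTop_coe_iff.2 (h ⟨p.2.1 ⊔ q.2.1, H.sup_mem p.2 q.2⟩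
      (le_sup_left : p.2.1 ≤ p.2.1 ⊔ q.2.1) (le_sup_right : q.2.1 ≤ p.2.1 ⊔ q.2.1))
    rintro _ ⟨_, x, hpx, hp', rfl⟩ hqx
    rw [H.injective hp'] at hpx
    exact H.topAlong_iff.2 fun y => (htop y).trans (sup_le hpx (H.le_iff.1 hqx))
  · intro x hx hle
    obtain ⟨x, rfl⟩ := H.le_self_iff.1 hx
    refine H.botAlong_iff.2 (H.isBot_of_forall_le B Prod.snd h3 fun p hp => H.le_iff.1 ?_)
    exact hle _ _ ((hmem _ _).2 ⟨p, hp, rfl, rfl⟩)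

theorem coverProperty_of_trace (H : IsDefinableOrder S ι) (hκ : κ.IsRegular)
    (hω : Infinite Λ → Cardinal.aleph0 < κ) (hT : CoverProperty {a : Λ // ι a ∈ S}) :
    CoverProperty Λ := by
  rcases finite_or_infinite Λ with hfin | hinf
  · refine (OrderIso.coverProperty_iff (P := {a : Λ // ι a ∈ S}) (Q := Λ)
      ⟨Equiv.subtypeUnivEquiv fun a => H.apply_mem_of_finite a, Iff.rfl⟩).1 hT
  · by_contra hΛ
    -- the code of a bad sequence is found in the submodel in two steps, first `I` and then `C`
    obtain ⟨I, hI⟩ := IsDefinable.exists_mem (S := S)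
      (P := fun I => ∃ C, ¬ HSet.HasFiniteExtent I ∧ CodesCovers hκ ι I C ∧
        ∀ B, HSet.HasFiniteExtent B → ¬ CodesRefinement hκ ι C B)
      (.ex (.and (IsDefinable.hasFiniteExtent hκ _).not (.and (H.isDefinable_codesCovers hκ _ _)
        (.all (.imp (.hasFiniteExtent hκ _) (H.isDefinable_codesRefinement hκ _ _).not)))))
      (H.exists_codesCovers_of_not_coverProperty hκ (hω hinf) hΛ)
    obtain ⟨C, hIfin, hC, hbad⟩ := IsDefinable.exists_mem (S := S)
      (P := fun C => ¬ HSet.HasFiniteExtent I.1 ∧ CodesCovers hκ ι I.1 C ∧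
        ∀ B, HSet.HasFiniteExtent B → ¬ CodesRefinement hκ ι C B)
      (.and (IsDefinable.hasFiniteExtent hκ _).not (.and (H.isDefinable_codesCovers hκ _ _)
        (.all (.imp (.hasFiniteExtent hκ _) (H.isDefinable_codesRefinement hκ _ _).not))))
      hI
    obtain ⟨B, hB, hBC⟩ := H.exists_codesRefinement hκ hT I C hIfin hC
    exact hbad B hB hBC

theorem coverProperty_iff_trace (H : IsDefinableOrder S ι) (hκ : κ.IsRegular)
    (hω : Infinite Λ → Cardinal.aleph0 < κ) :
    CoverProperty Λ ↔ CoverProperty {a : Λ // ι a ∈ S} :=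
  ⟨H.coverProperty_trace, H.coverProperty_of_trace hκ hω⟩

/-- The Wallman space of anything order isomorphic to the trace of `Λ` detects the cover property
of `Λ`. -/
theorem coverProperty_iff_isCSpace_wallman (H : IsDefinableOrder S ι) (hκ : κ.IsRegular)
    (hω : Infinite Λ → Cardinal.aleph0 < κ) (hΛ : IsSeparative Λ) {P : Type*} [PartialOrder P]
    (e : P ≃o {a : Λ // ι a ∈ S}) : CoverProperty Λ ↔ IsCSpace (Wallman P) := by
  let _ := H.distribLatticeTrace
  let _ := H.boundedOrderTrace
  exact (H.coverProperty_iff_trace hκ hω).trans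
    (Wallman.isCSpace_iff_of_orderIso (H.isSeparative_trace hΛ) e).symm

end IsDefinableOrder

end Sequences

/-! ### Lattices and spaces that belong to an elementary submodel -/

section Codes

variable {κ : Cardinal.{u}} {S : setLang.ElementarySubstructure (HSet κ)}

theorem aleph0_lt_of_infinite_elements {K : ZFSet.{u}} (hK : K ∈ HSet κ)
    (h : Infinite (Elements K)) : Cardinal.aleph0 < κ := by
  refine HSet.aleph0_lt_of_infinite hK (Set.infinite_coe_iff.1 ?_)
  exact h

theorem pair_mem_orderGraph {K : ZFSet.{u}} [PartialOrder (Elements K)] {x y : ZFSet.{u}} :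
    ZFSet.pair x y ∈ orderGraph K ↔ ∃ a b : Elements K, a ≤ b ∧ a.1 = x ∧ b.1 = y := by
  unfold orderGraph
  refine ZFSet.mem_sep.trans ?_
  constructor
  · rintro ⟨-, a, b, hab, h⟩
    obtain ⟨rfl, rfl⟩ := ZFSet.pair_inj.1 h
    exact ⟨a, b, hab, rfl, rfl⟩
  · rintro ⟨a, b, hab, rfl, rfl⟩
    exact ⟨ZFSet.pair_mem_prod.2 ⟨a.2, b.2⟩, a, b, hab, rfl⟩

/-- The elements of a set in `H(κ)`, as elements of `H(κ)`. -/
def elementsToHSet {K : ZFSet.{u}} (hK : K ∈ HSet κ) (a : Elements K) : HSet κ :=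
  ⟨a.1, HSet.mem_of_mem hK a.2⟩

theorem isDefinableOrder_elements (hκ : κ.IsRegular) {K : ZFSet.{u}} [PartialOrder (Elements K)]
    (c : S) (hc : c.1.1 = latticeCode K) (hK : K ∈ HSet κ) :
    IsDefinableOrder S (elementsToHSet hK) where
  injective a b h := by
    have h' : (elementsToHSet hK a).1 = (elementsToHSet hK b).1 := congrArg Subtype.val h
    exact Subtype.ext h'
  isDefinable t t' _ _ := by
    refine IsDefinable.congr (P := fun v => ∃ k g : HSet κ, c.1 = HSet.pair hκ k g ∧
      (HSet.pair hκ (t v) (t' v)).1 ∈ g.1)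
      (.ex (.ex (.and (.eq_pair hκ _ _ _) (.pair_mem hκ _ _ _)))) fun v => ?_
    have hmem : ∀ g : HSet κ, g.1 = orderGraph K →
        ((HSet.pair hκ (t v) (t' v)).1 ∈ g.1 ↔ LeAlong (elementsToHSet hK) (t v) (t' v)) := by
      intro g hg
      rw [hg]
      refine pair_mem_orderGraph.trans ?_
      simp only [LeAlong, elementsToHSet, Subtype.ext_iff]
    constructor
    · rintro ⟨k, g, h, hg⟩
      have h' : latticeCode K = ZFSet.pair k.1 g.1 := hc ▸ congrArg Subtype.val h
      exact (hmem g (ZFSet.pair_inj.1 h').2.symm).1 hg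
    · intro h
      have hcH : ZFSet.pair K (orderGraph K) ∈ HSet κ := (hc ▸ c.1.2 :)
      exact ⟨⟨K, hK⟩, ⟨_, HSet.snd_mem hcH⟩, Subtype.ext hc, (hmem _ rfl).2 h⟩

/-- A set of points of `X`, as a subset of `X`. -/
noncomputable def subsetOfElements {X : ZFSet.{u}} (s : Set (Elements X)) : ZFSet.{u} :=
  X.sep fun z => ∃ a ∈ s, a.1 = z

theorem mem_subsetOfElements {X : ZFSet.{u}} {s : Set (Elements X)} {z : ZFSet.{u}} :
    z ∈ subsetOfElements s ↔ ∃ a ∈ s, a.1 = z := by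
  refine ZFSet.mem_sep.trans ⟨And.right, fun h => ⟨?_, h⟩⟩
  obtain ⟨a, -, rfl⟩ := h
  exact a.2

theorem coe_mem_subsetOfElements {X : ZFSet.{u}} {s : Set (Elements X)} {a : Elements X} :
    a.1 ∈ subsetOfElements s ↔ a ∈ s := by
  rw [mem_subsetOfElements]
  refine ⟨?_, fun h => ⟨a, h, rfl⟩⟩
  rintro ⟨b, hb, hba⟩
  rwa [← Subtype.ext (p := fun z => z ∈ X) hba]

theorem subsetOfElements_subset {X : ZFSet.{u}} (s : Set (Elements X)) :
    subsetOfElements s ⊆ X := fun _ hz => (ZFSet.mem_sep.1 hz).1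

theorem subsetOfElements_subset_iff {X : ZFSet.{u}} {s t : Set (Elements X)} :
    subsetOfElements s ⊆ subsetOfElements t ↔ s ⊆ t := by
  refine ⟨fun h a ha => coe_mem_subsetOfElements.1 (h (coe_mem_subsetOfElements.2 ha)), ?_⟩
  intro h z hz
  obtain ⟨a, ha, rfl⟩ := mem_subsetOfElements.1 hz
  exact coe_mem_subsetOfElements.2 (h ha)

theorem subsetOfElements_setOf {X F : ZFSet.{u}} (hF : F ⊆ X) :
    subsetOfElements {a : Elements X | a.1 ∈ F} = F := by
  ext z
  rw [mem_subsetOfElements]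
  refine ⟨?_, fun hz => ⟨⟨z, hF hz⟩, hz, rfl⟩⟩
  rintro ⟨a, ha, rfl⟩
  exact ha

variable {X : ZFSet.{u}} [TopologicalSpace (Elements X)]

theorem mem_openSets {U : ZFSet.{u}} :
    U ∈ openSets X ↔ U ⊆ X ∧ IsOpen {a : Elements X | a.1 ∈ U} :=
  ZFSet.mem_sep.trans (and_congr_left fun _ => ZFSet.mem_powerset)

theorem mem_closedSets {F : ZFSet.{u}} :
    F ∈ closedSets X ↔ F ⊆ X ∧ IsClosed {a : Elements X | a.1 ∈ F} :=
  ZFSet.mem_sep.trans (and_congr_left fun _ => ZFSet.mem_powerset)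

/-- The closed subsets of a space `X ∈ H(κ)`, as elements of `H(κ)`. -/
noncomputable def closedsToHSet (hX : X ∈ HSet κ) (F : TopologicalSpace.Closeds (Elements X)) :
    HSet κ :=
  ⟨subsetOfElements (F : Set (Elements X)), HSet.mem_of_subset hX (subsetOfElements_subset _)⟩

theorem exists_closedsToHSet_eq_iff (hX : X ∈ HSet κ) {x : HSet κ} :
    (∃ F, closedsToHSet hX F = x) ↔ x.1 ∈ closedSets X := by
  rw [mem_closedSets]
  constructor
  · rintro ⟨F, rfl⟩
    refine ⟨subsetOfElements_subset _, ?_⟩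
    have : {a : Elements X | a.1 ∈ subsetOfElements (F : Set (Elements X))} = F :=
      Set.ext fun a => coe_mem_subsetOfElements
    exact this ▸ F.isClosed
  · rintro ⟨hx, hcl⟩
    exact ⟨⟨_, hcl⟩, Subtype.ext (subsetOfElements_setOf hx)⟩

theorem leAlong_closedsToHSet_iff (hX : X ∈ HSet κ) {x y : HSet κ} :
    LeAlong (closedsToHSet hX) x y ↔
      (x.1 ∈ closedSets X ∧ y.1 ∈ closedSets X) ∧ ∀ z : HSet κ, z.1 ∈ x.1 → z.1 ∈ y.1 := by
  rw [← exists_closedsToHSet_eq_iff hX, ← exists_closedsToHSet_eq_iff hX]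
  constructor
  · rintro ⟨F, G, hFG, rfl, rfl⟩
    exact ⟨⟨⟨F, rfl⟩, ⟨G, rfl⟩⟩, fun z hz => subsetOfElements_subset_iff.2 hFG hz⟩
  · rintro ⟨⟨⟨F, rfl⟩, ⟨G, rfl⟩⟩, h⟩
    refine ⟨F, G, subsetOfElements_subset_iff.1 fun z hz => ?_, rfl, rfl⟩
    exact h ⟨z, HSet.mem_of_mem (closedsToHSet hX F).2 hz⟩ hz

/-- A subset of `X` is closed if and only if its complement in `X` belongs to the topology. -/
theorem mem_closedSets_iff_exists_openSets {F : ZFSet.{u}} :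
    F ∈ closedSets X ↔ F ⊆ X ∧ ∃ U ∈ openSets X, ∀ z, z ∈ U ↔ z ∈ X ∧ z ∉ F := by
  rw [mem_closedSets]
  refine and_congr_right fun hF => ?_
  rw [← isOpen_compl_iff]
  constructor
  · intro h
    have hmem : ∀ z, z ∈ X.sep (fun z => z ∉ F) ↔ z ∈ X ∧ z ∉ F := fun z => ZFSet.mem_sep
    refine ⟨X.sep fun z => z ∉ F, mem_openSets.2 ⟨fun z hz => ((hmem z).1 hz).1, ?_⟩, hmem⟩
    convert h using 1
    ext a
    exact (hmem a.1).trans (and_iff_right a.2)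
  · rintro ⟨U, hU, hmem⟩
    convert (mem_openSets.1 hU).2 using 1
    ext a
    exact ((hmem a.1).trans (and_iff_right a.2)).symm

theorem isDefinable_closedSets (hκ : κ.IsRegular) (c : S) (hc : c.1.1 = spaceCode X) {α : Type}
    (t : (α → HSet κ) → HSet κ) [IsDefTerm S t] :
    IsDefinable S fun v => (t v).1 ∈ closedSets X := by
  refine IsDefinable.congr (P := fun v => ∃ k o : HSet κ, c.1 = HSet.pair hκ k o ∧
    (∀ z : HSet κ, z.1 ∈ (t v).1 → z.1 ∈ k.1) ∧
      ∃ U : HSet κ, U.1 ∈ o.1 ∧ ∀ z : HSet κ, z.1 ∈ U.1 ↔ z.1 ∈ k.1 ∧ ¬ z.1 ∈ (t v).1)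
    (.ex (.ex (.and (.eq_pair hκ _ _ _) (.and (.all (.imp (.mem _ _) (.mem _ _)))
      (.ex (.and (.mem _ _) (.all (.iff (.mem _ _) (.and (.mem _ _) (.not (.mem _ _)))))))))))
    fun v => ?_
  rw [mem_closedSets_iff_exists_openSets]
  have hcH : ZFSet.pair X (openSets X) ∈ HSet κ := (hc ▸ c.1.2 :)
  have hX := HSet.fst_mem hcH
  constructor
  · rintro ⟨k, o, h, hk, U, hU, hmem⟩
    have h' : spaceCode X = ZFSet.pair k.1 o.1 := hc ▸ congrArg Subtype.val h
    obtain ⟨h1, h2⟩ := ZFSet.pair_inj.1 h'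
    refine ⟨fun z hz => h1 ▸ hk ⟨z, HSet.mem_of_mem (t v).2 hz⟩ hz, U, h2 ▸ hU, fun z => ?_⟩
    rw [h1]
    exact ⟨fun hz => (hmem ⟨z, HSet.mem_of_mem U.2 hz⟩).1 hz,
      fun hz => (hmem ⟨z, HSet.mem_of_mem k.2 hz.1⟩).2 hz⟩
  · rintro ⟨hsub, U, hU, hmem⟩
    exact ⟨⟨X, hX⟩, ⟨_, HSet.snd_mem hcH⟩, Subtype.ext hc, fun z hz => hsub hz,
      ⟨U, HSet.mem_of_mem (HSet.snd_mem hcH) hU⟩, hU, fun z => hmem z.1⟩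

theorem isDefinableOrder_closeds (hκ : κ.IsRegular) (c : S) (hc : c.1.1 = spaceCode X)
    (hX : X ∈ HSet κ) : IsDefinableOrder S (closedsToHSet hX) where
  injective F G h := by
    have h' : subsetOfElements (F : Set (Elements X)) = subsetOfElements (G : Set (Elements X)) :=
      congrArg Subtype.val h
    exact le_antisymm (subsetOfElements_subset_iff.1 fun z hz => h' ▸ hz)
      (subsetOfElements_subset_iff.1 fun z hz => h' ▸ hz)
  isDefinable t t' _ _ := by
    refine IsDefinable.congr ?_ fun v => (leAlong_closedsToHSet_iff hX).symm
    refine .and (.and (isDefinable_closedSets hκ c hc _) (isDefinable_closedSets hκ c hc _)) ?_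
    exact .all (.imp (.mem _ _) (.mem _ _))

/-- The lattice `2^X ∩ M` is the trace on `M` of the lattice of closed sets. -/
noncomputable def closedTraceOrderIso (hX : X ∈ HSet κ) {M : Set ZFSet.{u}}
    (hM : ∀ x : HSet κ, x ∈ S ↔ x.1 ∈ M) :
    ClosedTrace X M ≃o {F : TopologicalSpace.Closeds (Elements X) // closedsToHSet hX F ∈ S} where
  toFun F := ⟨⟨{a | a.1 ∈ F.1}, (mem_closedSets.1 F.2.1).2⟩, (hM _).2 (by
    show subsetOfElements {a : Elements X | a.1 ∈ F.1} ∈ M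
    rw [subsetOfElements_setOf (mem_closedSets.1 F.2.1).1]
    exact F.2.2)⟩
  invFun F := ⟨(closedsToHSet hX F.1).1,
    (exists_closedsToHSet_eq_iff hX).1 ⟨F.1, rfl⟩, (hM _).1 F.2⟩
  left_inv F := Subtype.ext (subsetOfElements_setOf (mem_closedSets.1 F.2.1).1)
  right_inv F := Subtype.ext (TopologicalSpace.Closeds.ext
    (Set.ext fun _ => coe_mem_subsetOfElements))
  map_rel_iff' := by
    intro F G
    refine ⟨fun h z hz => ?_, fun h a ha => h ha⟩
    exact h (show (⟨z, (mem_closedSets.1 F.2.1).1 hz⟩ : Elements X) ∈ _ from hz)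

theorem infinite_of_infinite_closeds {Y : Type*} [TopologicalSpace Y]
    (h : Infinite (TopologicalSpace.Closeds Y)) : Infinite Y := by
  by_contra hY
  have := not_infinite_iff_finite.1 hY
  exact h.not_finite (Finite.of_injective (fun F : TopologicalSpace.Closeds Y => (F : Set Y))
    SetLike.coe_injective)

end Codes

theorem mainTheorem2 (X : ZFSet.{u}) [TopologicalSpace (Elements X)] [CompactSpace (Elements X)]
    [T2Space (Elements X)] (κ : Cardinal.{u}) (hκ : κ.IsRegular)
    (hX : X.powerset.powerset ∈ HSet κ) (M : Set ZFSet.{u}) (hM : IsElementarySubmodel M κ)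
    (hMc : M.Countable) (hXM : spaceCode X ∈ M) :
    (IsCSpace (Elements X) ↔ IsCSpace (Wallman (ClosedTrace X M))) ∧
      ∀ (K : ZFSet.{u}) [DistribLattice (Elements K)] [BoundedOrder (Elements K)],
        IsSeparative (Elements K) → latticeCode K ∈ M →
          (IsCSpace (Wallman (Elements K)) ↔ IsCSpace (Wallman (LatticeTrace K M))) := by
  obtain ⟨S, rfl⟩ := hM
  have hS : ∀ x : HSet κ, x ∈ S ↔ x.1 ∈ Subtype.val '' (S : Set (HSet κ)) := fun x =>
    (Subtype.val_injective.mem_set_image).symm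
  constructor
  · obtain ⟨c, hcS, hc⟩ := hXM
    have hXH : X ∈ HSet κ := HSet.fst_mem (y := openSets X) (by
      have := c.2
      rwa [hc] at this)
    refine (TopologicalSpace.Closeds.isClosedLatticeBase (Elements X)).isCSpace_iff.trans ?_
    exact (isDefinableOrder_closeds hκ ⟨c, hcS⟩ hc hXH).coverProperty_iff_isCSpace_wallman hκ
      (fun h => aleph0_lt_of_infinite_elements hXH (infinite_of_infinite_closeds h))
      (isSeparative_closeds _) (closedTraceOrderIso hXH hS)
  · rintro K _ _ hK ⟨c, hcS, hc⟩
    have hKH : K ∈ HSet κ := HSet.fst_mem (y := orderGraph K) (by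
      have := c.2
      rwa [hc] at this)
    refine (Wallman.isCSpace_iff hK).trans ?_
    exact (isDefinableOrder_elements hκ ⟨c, hcS⟩ hc hKH).coverProperty_iff_isCSpace_wallman hκ
      (aleph0_lt_of_infinite_elements hKH) hK
      ⟨Equiv.subtypeEquivRight fun a => (hS (elementsToHSet hKH a)).symm, Iff.rfl⟩
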